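/- Let $\mathbb{R}^{n+1,1}$ be Minkowski space $\mathbb{R}^{n+2}$ with the form $\langle x,y\rangle=-x_0y_0+\sum_{i=1}^{n+1}x_iy_i$, and for $\rho>0$ let $S^{n,1}_\rho=\{x\in\mathbb{R}^{n+1,1}:\langle x,x\rangle=\rho^2\}$ be de Sitter space of radius $\rho$ with the induced Lorentzian metric. Let $g$ be a smooth Riemannian metric on $S^n$, $n\ge 2$. An isometric embedding of $(S^n,g)$ into $S^{n,1}_\rho$ is a smooth embedding $X:S^n\to S^{n,1}_\rho$ whose induced metric is $g$ (so that $X$ is spacelike). Let $\nu$ be its downward pointing (i.e. $\nu_0<0$) timelike unit normal in $S^{n,1}_\rho$ and let $A_{ij}=\langle\nu,\partial_i\partial_jX\rangle$ be its second fundamental form. The principal curvatures $\lambda=(\lambda_1,\dots,\lambda_n)$ are the eigenvalues of $A$ with respect to $g$, and $|A|^2=g^{ik}g^{jl}A_{ij}A_{kl}$. Let $\Gamma_2$ be the connected component of $\{\lambda\in\mathbb{R}^n:\sum_{i<j}\lambda_i\lambda_j>0\}$ which contains the positive cone. The embedding is called admissible if $\lambda\in\Gamma_2$ at every point. (1) Let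 $g$ be a smooth metric of positive curvature on $S^2$. Then there is $\rho_0>0$ such that for every $\rho$ with $0<\rho<\rho_0$ there is a constant $C=C(g,\rho)>0$ such that every admissible isometric embedding of $(S^2,g)$ into $S^{2,1}_\rho$ satisfies $|A|^2\le C$ everywhere on $S^2$. (2) Let $n\ge 2$, let $g$ be a smooth metric on $S^n$ and let $\rho>0$ be such that the scalar curvature $R$ of $g$ satisfies $\rho^{-2}n(n-2)<R<\rho^{-2}n(n-1)$ at every point of $S^n$. Then there is a constant $C=C(n,g,\rho)>0$ such that every admissible isometric embedding of $(S^n,g)$ into $S^{n,1}_\rho$ satisfies $|A|^2\le C$ everywhere on $S^n$. -/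

import Mathlib

open scoped Manifold ContDiff

noncomputable section

namespace WeylDeSitter

/-- Coordinate space `ℝⁿ` of the charts. -/
abbrev Coord (n : ℕ) : Type := EuclideanSpace ℝ (Fin n)

/-- The smooth `n`-sphere, as a manifold. -/
abbrev Sph (n : ℕ) : Type := Metric.sphere (0 : EuclideanSpace ℝ (Fin (n + 1))) 1

/-- Smooth (`C^∞`) Riemannian metrics on the `n`-sphere. -/
abbrev SphMetric (n : ℕ) : Type :=
  Bundle.ContMDiffRiemannianMetric (𝓡 n) ∞ (Coord n) (fun p : Sph n => TangentSpace (𝓡 n) p)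

/-! ### Riemannian geometry in coordinates -/

/-- The partial derivative `∂ᵢ f (y)`. -/
def partialD {n : ℕ} {F : Type*} [NormedAddCommGroup F] [NormedSpace ℝ F]
    (i : Fin n) (f : Coord n → F) (y : Coord n) : F :=
  fderiv ℝ f y (EuclideanSpace.single i 1)

/-- Christoffel symbols `Γᵏᵢⱼ` of the metric with components `G`. -/
def christoffel {n : ℕ} (G : Coord n → Matrix (Fin n) (Fin n) ℝ)
    (k i j : Fin n) (y : Coord n) : ℝ :=
  (1 / 2) * ∑ l, (G y)⁻¹ k l *
    (partialD i (fun z => G z j l) y + partialD j (fun z => G z i l) y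
      - partialD l (fun z => G z i j) y)

/-- Components `Rˡₖᵢⱼ` of the Riemann curvature operator,
`(∇ᵢ∇ⱼ - ∇ⱼ∇ᵢ) ∂ₖ = ∑ₗ Rˡₖᵢⱼ ∂ₗ`. -/
def riemann {n : ℕ} (G : Coord n → Matrix (Fin n) (Fin n) ℝ)
    (l k i j : Fin n) (y : Coord n) : ℝ :=
  partialD i (christoffel G l j k) y - partialD j (christoffel G l i k) y
    + ∑ m, (christoffel G l i m y * christoffel G m j k y
      - christoffel G l j m y * christoffel G m i k y)

/-- Ricci curvature `Ricₖⱼ = ∑ᵢ Rⁱₖᵢⱼ` (positive on round spheres). -/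
def ricci {n : ℕ} (G : Coord n → Matrix (Fin n) (Fin n) ℝ) (k j : Fin n) (y : Coord n) : ℝ :=
  ∑ i, riemann G i k i j y

/-- Scalar curvature `gᵏʲ Ricₖⱼ`. -/
def scalar {n : ℕ} (G : Coord n → Matrix (Fin n) (Fin n) ℝ) (y : Coord n) : ℝ :=
  ∑ k, ∑ j, (G y)⁻¹ k j * ricci G k j y

/-- `g(R(v, w) w, v)`, the numerator of the sectional curvature of the plane spanned
by `v` and `w`. -/
def sectionalNum {n : ℕ} (G : Coord n → Matrix (Fin n) (Fin n) ℝ) (y : Coord n)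
    (v w : Fin n → ℝ) : ℝ :=
  ∑ m, ∑ l, ∑ k, ∑ i, ∑ j, G y m l * riemann G l k i j y * v i * w j * w k * v m

/-! ### The sphere in its charts -/

/-- The local parametrization of the sphere inverse to the preferred chart at `p`. -/
def param {n : ℕ} (p : Sph n) : Coord n → Sph n := (extChartAt (𝓡 n) p).symm

/-- The coordinates of `p` in the preferred chart at `p`. -/
def base {n : ℕ} (p : Sph n) : Coord n := extChartAt (𝓡 n) p p

/-- Metric components `gᵢⱼ = g(∂ᵢ, ∂ⱼ)` in the preferred chart at `p`. -/
def metricComp {n : ℕ} (g : SphMetric n) (p : Sph n) (y : Coord n) :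
    Matrix (Fin n) (Fin n) ℝ :=
  Matrix.of fun i j =>
    g.inner (param p y)
      (mfderiv 𝓘(ℝ, Coord n) (𝓡 n) (param p) y (EuclideanSpace.single i (1 : ℝ) : Coord n))
      (mfderiv 𝓘(ℝ, Coord n) (𝓡 n) (param p) y (EuclideanSpace.single j (1 : ℝ) : Coord n))

/-- The scalar curvature `R` of `(Sⁿ, g)` at `p`. -/
def scalarCurvature {n : ℕ} (g : SphMetric n) (p : Sph n) : ℝ :=
  scalar (metricComp g p) (base p)

/-- `g` has positive (sectional) curvature: on the 2-sphere, positive Gauss curvature. -/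
def PositiveCurvature {n : ℕ} (g : SphMetric n) : Prop :=
  ∀ p : Sph n, ∀ v w : Fin n → ℝ, LinearIndependent ℝ ![v, w] →
    0 < sectionalNum (metricComp g p) (base p) v w

/-! ### Minkowski space and scaled de Sitter space -/

/-- The vector space underlying Minkowski space `ℝ^{n+1,1}`; coordinate `0` is time. -/
abbrev Mink (n : ℕ) : Type := Fin (n + 2) → ℝ

/-- The Minkowski form `-x₀y₀ + x₁y₁ + ⋯ + xₙ₊₁yₙ₊₁`. -/
def mink {n : ℕ} (x y : Mink n) : ℝ :=
  -(x 0 * y 0) + ∑ i : Fin (n + 1), x i.succ * y i.succ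

/-- Scaled de Sitter space `S^{n,1}_ρ`, with the metric induced by `mink`. -/
def deSitter (n : ℕ) (ρ : ℝ) : Set (Mink n) := {x | mink x x = ρ ^ 2}

/-- `X` is a smooth isometric embedding of `(Sⁿ, g)` into `S^{n,1}_ρ`.
It is an immersion and spacelike because the pulled back form is the Riemannian metric `g`. -/
structure IsIsometricEmbedding {n : ℕ} (g : SphMetric n) (ρ : ℝ) (X : Sph n → Mink n) :
    Prop where
  mem_deSitter : ∀ p, X p ∈ deSitter n ρ
  contMDiff : ContMDiff (𝓡 n) 𝓘(ℝ, Mink n) ∞ X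
  isEmbedding : Topology.IsEmbedding X
  isometric : ∀ (p : Sph n) (v w : TangentSpace (𝓡 n) p),
    mink (n := n) (mfderiv (𝓡 n) 𝓘(ℝ, Mink n) X p v) (mfderiv (𝓡 n) 𝓘(ℝ, Mink n) X p w)
      = g.inner p v w

/-- `ν` is the downward pointing timelike unit normal of the hypersurface `X` of de Sitter space:
it is tangent to de Sitter space (Minkowski orthogonal to the position vector), orthogonal to
the hypersurface, of square `-1`, and points to the past. -/
structure IsDownwardUnitNormal {n : ℕ} (X ν : Sph n → Mink n) : Prop where
  tangent : ∀ p, mink (ν p) (X p) = 0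
  normal : ∀ (p : Sph n) (v : TangentSpace (𝓡 n) p),
    mink (n := n) (ν p) (mfderiv (𝓡 n) 𝓘(ℝ, Mink n) X p v) = 0
  unit : ∀ p, mink (ν p) (ν p) = -1
  downward : ∀ p, ν p 0 < 0

/-- Second fundamental form `Aᵢⱼ = ⟨ν, ∂ᵢ∂ⱼX⟩` at `p`, in the preferred chart at `p`.
Since `ν` is orthogonal to the position vector, the flat derivative and the
covariant derivative of de Sitter space have the same `ν`-component. -/
def secondFF {n : ℕ} (X ν : Sph n → Mink n) (p : Sph n) : Matrix (Fin n) (Fin n) ℝ :=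
  Matrix.of fun i j =>
    mink (ν p) (partialD i (fun z => partialD j (fun y => X (param p y)) z) (base p))

/-- `|A|² = gⁱᵏ gʲˡ Aᵢⱼ Aₖₗ` at `p`. -/
def normSqA {n : ℕ} (g : SphMetric n) (X ν : Sph n → Mink n) (p : Sph n) : ℝ :=
  ∑ i, ∑ j, ∑ k, ∑ l,
    (metricComp g p (base p))⁻¹ i k * (metricComp g p (base p))⁻¹ j l
      * secondFF X ν p i j * secondFF X ν p k l

/-- `lam` lists the principal curvatures at `p`, i.e. the eigenvalues of `A` with respect to `g`
with multiplicity: the columns of `E` are a `g`-orthonormal basis of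
principal directions, with `A(eₐ, e_b) = lamₐ δ_{ab}`. -/
def IsPrincipalCurvatures {n : ℕ} (g : SphMetric n) (X ν : Sph n → Mink n) (p : Sph n)
    (lam : Fin n → ℝ) : Prop :=
  ∃ E : Matrix (Fin n) (Fin n) ℝ,
    E.transpose * metricComp g p (base p) * E = 1 ∧
    E.transpose * secondFF X ν p * E = Matrix.diagonal lam

/-- The second elementary symmetric polynomial `P₂`. -/
def P2 {n : ℕ} (x : Fin n → ℝ) : ℝ := ∑ i, ∑ j ∈ Finset.Ioi i, x i * x j

/-- The cone `Γ₂`: the connected component of `{P₂ > 0}` containing the positive cone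
(which is connected and contains `(1, …, 1)`). -/
def Gamma2 (n : ℕ) : Set (Fin n → ℝ) :=
  connectedComponentIn {x : Fin n → ℝ | 0 < P2 x} (fun _ => 1)

/-- Admissibility: at every point the principal curvatures lie in `Γ₂`. -/
def Admissible {n : ℕ} (g : SphMetric n) (X ν : Sph n → Mink n) : Prop :=
  ∀ p : Sph n, ∃ lam : Fin n → ℝ, IsPrincipalCurvatures g X ν p lam ∧ lam ∈ Gamma2 n

/-- Every admissible isometric embedding of `(Sⁿ, g)` into `S^{n,1}_ρ` satisfies `|A|² ≤ C`
everywhere. -/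
def CurvatureBound {n : ℕ} (g : SphMetric n) (ρ C : ℝ) : Prop :=
  ∀ X ν : Sph n → Mink n, IsIsometricEmbedding g ρ X → IsDownwardUnitNormal X ν →
    Admissible g X ν → ∀ p : Sph n, normSqA g X ν p ≤ C

end WeylDeSitter

end

/-! Everything happens at a maximum of the mean curvature `H`. The Gauss equation (`scalar_eq`)
gives `2 σ₂ = ρ⁻² n (n - 1) - R`, so `σ₂` and all its derivatives are determined by `g` and `ρ`,
whatever the embedding is. On `Γ₂` one has `H > 0` and `H² = |A|² + 2 σ₂`, hence `|A|² ≤ H²`, and it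
suffices to bound `max H`.

At a point where `H` is maximal, choose coordinates that are normal to first order and diagonalize
`A`. Differentiating `2 σ₂ = H² - |A|²` twice, with `∇H = 0` and the term `-|∇A|²` discarded, yields
`Δσ₂ ≤ H ΔH - ∑ λᵢ ΔAᵢᵢ`. Simons' identity (`simons`) replaces `∑ λᵢ ΔAᵢᵢ` by `∑ λₖ Hₖₖ` plus a
quartic expression in `λ`. The remaining second order term `∑ (H - λₖ) Hₖₖ` is nonpositive, because
`λₖ ≤ H` on `Γ₂` and `Hₖₖ ≤ 0` at a maximum. The quartic expression is controlled by `H tr A³ - |A|⁴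
≤ σ₂ |A|²` (`sum_mul_sum_cube_le`). The result, `estimate_at_max`, is `((n - 1) ρ⁻² - σ₂) |A|² ≤ 2
ρ⁻² σ₂ - Δσ₂`, whose right side is intrinsic. So a bound follows whenever `σ₂ < (n - 1) ρ⁻²`.

Both assertions give this strict inequality. On surfaces `σ₂ = ρ⁻² - K` with `K > 0`, for every `ρ`,
so no smallness of `ρ` enters the estimate. In general `R > ρ⁻² n (n - 2)` means `σ₂ < ρ⁻² n / 2`,
and `n / 2 ≤ n - 1` for `n ≥ 2`. The constant is made uniform by proving a local bound near each
point (`exists_local_bound`) and using compactness of the sphere (`exists_curvatureBound`). -/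

namespace WeylDeSitter

open Filter Topology

/-! ### Calculus of coordinate partial derivatives -/

section PartialDerivatives

variable {n : ℕ} {F : Type*} [NormedAddCommGroup F] [NormedSpace ℝ F]

lemma partialD_congr {f g : Coord n → F} {y : Coord n} (h : f =ᶠ[𝓝 y] g) (i : Fin n) :
    partialD i f y = partialD i g y := by
  rw [partialD, h.fderiv_eq, partialD]

lemma eventuallyEq_partialD {f g : Coord n → F} {y : Coord n} (h : f =ᶠ[𝓝 y] g) (i : Fin n) :
    partialD i f =ᶠ[𝓝 y] partialD i g := by
  filter_upwards [h.eventuallyEq_nhds] with z hz using partialD_congr hz i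

lemma ContDiffAt.partialD {f : Coord n → F} {y : Coord n} {k m : ℕ∞ω}
    (h : ContDiffAt ℝ k f y) (hm : m + 1 ≤ k) (i : Fin n) :
    ContDiffAt ℝ m (partialD i f) y :=
  (h.fderiv_right hm).clm_apply contDiffAt_const

lemma ContDiff.partialD {f : Coord n → F} (h : ContDiff ℝ ∞ f) (i : Fin n) :
    ContDiff ℝ ∞ (partialD i f) :=
  (h.fderiv_right (by simp)).clm_apply contDiff_const

lemma partialD_comm {f : Coord n → F} {y : Coord n} (h : ContDiffAt ℝ 2 f y) (i j : Fin n) :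
    partialD i (partialD j f) y = partialD j (partialD i f) y := by
  have hd : DifferentiableAt ℝ (fderiv ℝ f) y :=
    (h.fderiv_right (m := 1) (by norm_num)).differentiableAt (by norm_num)
  have key : ∀ i j : Fin n, partialD i (partialD j f) y
      = fderiv ℝ (fderiv ℝ f) y (EuclideanSpace.single i 1) (EuclideanSpace.single j 1) := by
    intro i j
    unfold partialD
    rw [fderiv_clm_apply hd (differentiableAt_const _)]
    simp
  rw [key, key]
  exact (h.isSymmSndFDerivAt (by simp)) _ _

lemma partialD_const (c : F) (i : Fin n) (y : Coord n) : partialD i (fun _ => c) y = 0 := by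
  simp [partialD]

lemma partialD_coord (a i : Fin n) (y : Coord n) :
    partialD i (fun u : Coord n => u a) y = if a = i then 1 else 0 := by
  unfold partialD
  have : (fun u : Coord n => u a) = (EuclideanSpace.proj a : Coord n →L[ℝ] ℝ) := rfl
  rw [this, ContinuousLinearMap.fderiv]
  simp

lemma partialD_add {f g : Coord n → F} {y : Coord n} (hf : DifferentiableAt ℝ f y)
    (hg : DifferentiableAt ℝ g y) (i : Fin n) :
    partialD i (fun z => f z + g z) y = partialD i f y + partialD i g y := by
  unfold partialD
  rw [fderiv_fun_add hf hg]; rfl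

lemma partialD_sub {f g : Coord n → F} {y : Coord n} (hf : DifferentiableAt ℝ f y)
    (hg : DifferentiableAt ℝ g y) (i : Fin n) :
    partialD i (fun z => f z - g z) y = partialD i f y - partialD i g y := by
  unfold partialD
  rw [fderiv_fun_sub hf hg]; rfl

lemma partialD_sum {ι : Type*} (s : Finset ι) {f : ι → Coord n → F} {y : Coord n}
    (hf : ∀ a ∈ s, DifferentiableAt ℝ (f a) y) (i : Fin n) :
    partialD i (fun z => ∑ a ∈ s, f a z) y = ∑ a ∈ s, partialD i (f a) y := by
  unfold partialD
  rw [fderiv_fun_sum hf]; simp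

lemma partialD_smul {c : Coord n → ℝ} {f : Coord n → F} {y : Coord n}
    (hc : DifferentiableAt ℝ c y) (hf : DifferentiableAt ℝ f y) (i : Fin n) :
    partialD i (fun z => c z • f z) y = c y • partialD i f y + partialD i c y • f y := by
  unfold partialD
  rw [fderiv_fun_smul hc hf]; simp

lemma partialD_mul {c f : Coord n → ℝ} {y : Coord n}
    (hc : DifferentiableAt ℝ c y) (hf : DifferentiableAt ℝ f y) (i : Fin n) :
    partialD i (fun z => c z * f z) y = c y * partialD i f y + partialD i c y * f y :=
  partialD_smul hc hf i

lemma partialD_const_mul {f : Coord n → ℝ} {y : Coord n} (c : ℝ)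
    (hf : DifferentiableAt ℝ f y) (i : Fin n) :
    partialD i (fun z => c * f z) y = c * partialD i f y := by
  rw [partialD_mul (differentiableAt_const c) hf, partialD_const]; simp

lemma partialD_partialD_mul {c f : Coord n → ℝ} {y : Coord n}
    (hc : ContDiffAt ℝ 2 c y) (hf : ContDiffAt ℝ 2 f y) (i j : Fin n) :
    partialD i (partialD j (fun z => c z * f z)) y
      = c y * partialD i (partialD j f) y + partialD i c y * partialD j f y
        + partialD j c y * partialD i f y + partialD i (partialD j c) y * f y := by
  have e : partialD j (fun z => c z * f z)
      =ᶠ[𝓝 y] fun z => c z * partialD j f z + partialD j c z * f z := by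
    filter_upwards [hc.eventually (by simp), hf.eventually (by simp)] with z h1 h2
    exact partialD_mul (h1.differentiableAt (by simp)) (h2.differentiableAt (by simp)) j
  have dc := hc.differentiableAt (by simp)
  have df := hf.differentiableAt (by simp)
  have dc' := (ContDiffAt.partialD (m := 1) hc (by norm_num) j).differentiableAt (by simp)
  have df' := (ContDiffAt.partialD (m := 1) hf (by norm_num) j).differentiableAt (by simp)
  rw [partialD_congr e, partialD_add (dc.fun_mul df') (dc'.fun_mul df), partialD_mul dc df',
    partialD_mul dc' df]
  ring

lemma partialD_partialD_sum {ι : Type*} (s : Finset ι) {f : ι → Coord n → F} {y : Coord n}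
    (hf : ∀ a ∈ s, ContDiffAt ℝ 2 (f a) y) (i j : Fin n) :
    partialD i (partialD j (fun z => ∑ a ∈ s, f a z)) y
      = ∑ a ∈ s, partialD i (partialD j (f a)) y := by
  have e : partialD j (fun z => ∑ a ∈ s, f a z) =ᶠ[𝓝 y] fun z => ∑ a ∈ s, partialD j (f a) z := by
    have : ∀ᶠ z in 𝓝 y, ∀ a ∈ s, ContDiffAt ℝ 2 (f a) z :=
      (Filter.eventually_all_finset s).2 fun a ha => (hf a ha).eventually (by simp)
    filter_upwards [this] with z hz
    exact partialD_sum s (fun a ha => (hz a ha).differentiableAt (by simp)) j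
  rw [partialD_congr e, partialD_sum s fun a ha =>
    (ContDiffAt.partialD (m := 1) (hf a ha) (by norm_num) j).differentiableAt (by simp)]

lemma fderiv_eq_sum_partialD (f : Coord n → F) (y v : Coord n) :
    fderiv ℝ f y v = ∑ a, v a • partialD a f y := by
  have hv : v = ∑ a, v a • EuclideanSpace.single a (1 : ℝ) := by
    ext b
    simp [Finset.sum_apply, Pi.single_apply]
  conv_lhs => rw [hv]
  simp [partialD, map_sum]

lemma partialD_apply {τ : Coord n → Coord n} {y : Coord n} (h : DifferentiableAt ℝ τ y)
    (i a : Fin n) : partialD i (fun u => τ u a) y = partialD i τ y a := by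
  unfold partialD
  have : (fun u => τ u a) = (EuclideanSpace.proj a : Coord n →L[ℝ] ℝ) ∘ τ := rfl
  rw [this, fderiv_comp _ (ContinuousLinearMap.differentiableAt _) h, ContinuousLinearMap.fderiv]
  rfl

/-- Chain rule in coordinates. -/
lemma partialD_comp {Z : Coord n → F} {τ : Coord n → Coord n} {y : Coord n}
    (hZ : DifferentiableAt ℝ Z (τ y)) (hτ : DifferentiableAt ℝ τ y) (i : Fin n) :
    partialD i (fun u => Z (τ u)) y = ∑ a, partialD i (fun u => τ u a) y • partialD a Z (τ y) := by
  have : partialD i (fun u => Z (τ u)) y = fderiv ℝ Z (τ y) (partialD i τ y) := by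
    unfold partialD
    have : (fun u => Z (τ u)) = Z ∘ τ := rfl
    rw [this, fderiv_comp _ hZ hτ]
    rfl
  rw [this, fderiv_eq_sum_partialD]
  simp_rw [partialD_apply hτ]

/-- Second order chain rule in coordinates. -/
lemma partialD_partialD_comp {Z : Coord n → F} {τ : Coord n → Coord n} {y : Coord n}
    (hZ : ContDiffAt ℝ 2 Z (τ y)) (hτ : ContDiffAt ℝ 2 τ y) (i j : Fin n) :
    partialD i (partialD j (fun u => Z (τ u))) y
      = ∑ a, (partialD i (partialD j fun u => τ u a) y • partialD a Z (τ y)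
        + partialD j (fun u => τ u a) y •
          ∑ b, partialD i (fun u => τ u b) y • partialD b (partialD a Z) (τ y)) := by
  have hτa : ∀ a, ContDiffAt ℝ 2 (fun u => τ u a) y := fun a =>
    (EuclideanSpace.proj a : Coord n →L[ℝ] ℝ).contDiff.contDiffAt.comp y hτ
  have dτ := hτ.differentiableAt (by simp)
  have e : partialD j (fun u => Z (τ u)) =ᶠ[𝓝 y]
      fun u => ∑ a, partialD j (fun u => τ u a) u • partialD a Z (τ u) := by
    filter_upwards [hτ.eventually (by simp),
      hτ.continuousAt.eventually (hZ.eventually (by simp))] with z h1 h2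
    exact partialD_comp (h2.differentiableAt (by simp)) (h1.differentiableAt (by simp)) j
  have d1 : ∀ a, DifferentiableAt ℝ (partialD j fun u => τ u a) y := fun a =>
    (ContDiffAt.partialD (m := 1) (hτa a) (by norm_num) j).differentiableAt (by simp)
  have d2 : ∀ a, DifferentiableAt ℝ (partialD a Z) (τ y) := fun a =>
    (ContDiffAt.partialD (m := 1) hZ (by norm_num) a).differentiableAt (by simp)
  have d3 : ∀ a, DifferentiableAt ℝ (fun u => partialD a Z (τ u)) y := fun a => (d2 a).comp y dτ
  rw [partialD_congr e, partialD_sum _ fun a _ => (d1 a).fun_smul (d3 a)]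
  refine Finset.sum_congr rfl fun a _ => ?_
  rw [partialD_smul (d1 a) (d3 a), partialD_comp (d2 a) dτ, add_comm]

/-- First and second order necessary conditions at a local maximum. -/
lemma partialD_of_isLocalMax {f : Coord n → ℝ} {y : Coord n} (h : IsLocalMax f y)
    (hf : ContDiffAt ℝ 2 f y) (i : Fin n) :
    partialD i f y = 0 ∧ partialD i (partialD i f) y ≤ 0 := by
  refine ⟨by rw [partialD, h.fderiv_eq_zero]; rfl, ?_⟩
  set e : Coord n := EuclideanSpace.single i 1
  set l : ℝ → Coord n := fun t => y + t • e
  have hl : ∀ t, HasDerivAt l e t := fun t => by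
    have := ((hasDerivAt_id t).smul_const e).const_add y
    rw [one_smul] at this
    exact this
  have hlc : Continuous l := continuous_iff_continuousAt.2 fun t => (hl t).continuousAt
  have l0 : l 0 = y := by simp [l]
  have hd : ∀ g : Coord n → ℝ, ∀ t, DifferentiableAt ℝ g (l t) →
      deriv (g ∘ l) t = partialD i g (l t) := fun g t hg =>
    (hg.hasFDerivAt.comp_hasDerivAt t (hl t)).deriv
  have ev : ∀ᶠ t in 𝓝 (0 : ℝ), ContDiffAt ℝ 2 f (l t) :=
    hlc.continuousAt.eventually (by rw [l0]; exact hf.eventually (by simp))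
  have e1 : deriv (f ∘ l) =ᶠ[𝓝 0] partialD i f ∘ l := by
    filter_upwards [ev] with t ht using hd f t (ht.differentiableAt (by simp))
  have e2 : deriv (deriv (f ∘ l)) 0 = partialD i (partialD i f) y := by
    rw [e1.deriv_eq, hd _ _ (by
      rw [l0]; exact (ContDiffAt.partialD (m := 1) hf (by norm_num) i).differentiableAt (by simp)),
      l0]
  have hmax : IsLocalMax (f ∘ l) 0 := by
    have : IsLocalMax f (l 0) := by rwa [l0]
    exact this.comp_continuous hlc.continuousAt
  have hcont : ContinuousAt (f ∘ l) 0 := by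
    refine ContinuousAt.comp ?_ hlc.continuousAt
    rw [l0]; exact hf.continuousAt
  by_contra hpos
  push Not at hpos
  -- If the second derivative were positive, the point would also be a local minimum, so the
  -- function would be locally constant along the line and its second derivative would vanish.
  have hmin := isLocalMin_of_deriv_deriv_pos (by rwa [e2]) hmax.deriv_eq_zero hcont
  have hconst : f ∘ l =ᶠ[𝓝 0] fun _ => (f ∘ l) 0 := by
    filter_upwards [hmin, hmax] with t h1 h2 using le_antisymm h2 h1
  have : deriv (deriv (f ∘ l)) 0 = 0 := by
    rw [hconst.deriv.deriv_eq]; simp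
  rw [e2] at this
  exact hpos.ne' this

end PartialDerivatives

/-! ### The Minkowski form and its product rule -/

section MinkowskiForm

/-- The Minkowski form as a bilinear map. -/
noncomputable def minkB (n : ℕ) : Mink n →L[ℝ] Mink n →L[ℝ] ℝ :=
  (LinearMap.mk₂ ℝ (fun x y : Mink n => mink x y)
    (fun x x' y => by simp only [mink, Pi.add_apply, add_mul, Finset.sum_add_distrib]; ring)
    (fun c x y => by
      simp only [mink, Pi.smul_apply, smul_eq_mul, mul_assoc, ← Finset.mul_sum]; ring)
    (fun x y y' => by simp only [mink, Pi.add_apply, mul_add, Finset.sum_add_distrib]; ring)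
    (fun c x y => by
      simp only [mink, Pi.smul_apply, smul_eq_mul, mul_left_comm _ c, ← Finset.mul_sum]
      ring)).toContinuousBilinearMap

variable {n : ℕ}

lemma minkB_apply (x y : Mink n) : minkB n x y = mink x y := rfl

lemma mink_comm (x y : Mink n) : mink x y = mink y x := by
  simp only [mink, mul_comm]

lemma mink_add_left (x y z : Mink n) : mink (x + y) z = mink x z + mink y z := by
  simp only [← minkB_apply, map_add, add_apply]
lemma mink_add_right (x y z : Mink n) : mink x (y + z) = mink x y + mink x z := by
  simp only [← minkB_apply, map_add]
lemma mink_sub_left (x y z : Mink n) : mink (x - y) z = mink x z - mink y z := by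
  simp only [← minkB_apply, map_sub, sub_apply]
lemma mink_sub_right (x y z : Mink n) : mink x (y - z) = mink x y - mink x z := by
  simp only [← minkB_apply, map_sub]
lemma mink_smul_left (c : ℝ) (x y : Mink n) : mink (c • x) y = c * mink x y := by
  simp [← minkB_apply]
lemma mink_smul_right (c : ℝ) (x y : Mink n) : mink x (c • y) = c * mink x y := by
  simp [← minkB_apply]
lemma mink_zero_left (x : Mink n) : mink 0 x = 0 := by
  simp [← minkB_apply]
lemma mink_zero_right (x : Mink n) : mink x 0 = 0 := by
  simp [← minkB_apply]
lemma mink_sum_left {ι : Type*} (s : Finset ι) (f : ι → Mink n) (y : Mink n) :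
    mink (∑ a ∈ s, f a) y = ∑ a ∈ s, mink (f a) y := by
  simp [← minkB_apply, map_sum]
lemma mink_sum_right {ι : Type*} (s : Finset ι) (f : ι → Mink n) (y : Mink n) :
    mink y (∑ a ∈ s, f a) = ∑ a ∈ s, mink y (f a) := by
  simp [← minkB_apply, map_sum]

lemma eq_zero_of_mink_eq_zero {v : Mink n} (h : ∀ w, mink v w = 0) : v = 0 := by
  ext a
  have := h (Pi.single a 1)
  induction a using Fin.cases with
  | zero => simpa [mink, Pi.single_apply] using this
  | succ j => simpa [mink, Pi.single_apply, (Fin.succ_ne_zero j).symm] using this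

lemma ContDiffAt.mink {f g : Coord n → Mink n} {y : Coord n} {k : ℕ∞ω}
    (hf : ContDiffAt ℝ k f y) (hg : ContDiffAt ℝ k g y) :
    ContDiffAt ℝ k (fun z => mink (f z) (g z)) y :=
  (((minkB n).contDiff.contDiffAt.comp y hf).clm_apply hg :)

lemma ContDiff.mink {f g : Coord n → Mink n} {k : ℕ∞ω}
    (hf : ContDiff ℝ k f) (hg : ContDiff ℝ k g) :
    ContDiff ℝ k (fun z => mink (f z) (g z)) :=
  (((minkB n).contDiff.comp hf).clm_apply hg :)

lemma partialD_mink {f g : Coord n → Mink n} {y : Coord n} (hf : DifferentiableAt ℝ f y)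
    (hg : DifferentiableAt ℝ g y) (i : Fin n) :
    partialD i (fun z => mink (f z) (g z)) y
      = mink (partialD i f y) (g y) + mink (f y) (partialD i g y) := by
  unfold partialD
  have := ((minkB n).hasFDerivAt_of_bilinear hf.hasFDerivAt hg.hasFDerivAt).fderiv
  simp only [minkB_apply] at this
  rw [this]
  simp [minkB_apply, add_comm]

end MinkowskiForm

/-! ### Algebra of principal curvatures and of the cone `Γ₂` -/

section PrincipalCurvatures

variable {n : ℕ}

/-- Substituting this for `G⁻¹` and cycling traces turns every contraction with the inverse metric
into a sum over principal curvatures. -/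
lemma inv_eq_mul_transpose {G E : Matrix (Fin n) (Fin n) ℝ} (hG : E.transpose * G * E = 1) :
    G⁻¹ = E * E.transpose := by
  have h : E * (E.transpose * G) = 1 := mul_eq_one_comm.1 hG
  exact Matrix.inv_eq_left_inv (by rw [Matrix.mul_assoc, h])

lemma trace_inv_mul {G A E : Matrix (Fin n) (Fin n) ℝ} {lam : Fin n → ℝ}
    (hG : E.transpose * G * E = 1) (hA : E.transpose * A * E = Matrix.diagonal lam) :
    (G⁻¹ * A).trace = ∑ i, lam i := by
  rw [inv_eq_mul_transpose hG, Matrix.mul_assoc, Matrix.trace_mul_comm, hA, Matrix.trace_diagonal]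

lemma trace_inv_mul_sq {G A E : Matrix (Fin n) (Fin n) ℝ} {lam : Fin n → ℝ}
    (hG : E.transpose * G * E = 1) (hA : E.transpose * A * E = Matrix.diagonal lam) :
    (G⁻¹ * A * (G⁻¹ * A)).trace = ∑ i, lam i ^ 2 := by
  have : G⁻¹ * A * (G⁻¹ * A) = E * (E.transpose * A * E * E.transpose * A) := by
    rw [inv_eq_mul_transpose hG]; simp only [Matrix.mul_assoc]
  rw [this, Matrix.trace_mul_comm,
    show E.transpose * A * E * E.transpose * A * E
      = E.transpose * A * E * (E.transpose * A * E) by simp only [Matrix.mul_assoc],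
    hA, Matrix.diagonal_mul_diagonal, Matrix.trace_diagonal]
  simp only [sq]

lemma sum_inv_mul_inv {G A E : Matrix (Fin n) (Fin n) ℝ} {lam : Fin n → ℝ}
    (hG : E.transpose * G * E = 1) (hA : E.transpose * A * E = Matrix.diagonal lam) :
    ∑ i, ∑ j, ∑ k, ∑ l, G⁻¹ i k * G⁻¹ j l * A i j * A k l = ∑ i, lam i ^ 2 := by
  have h1 : ∑ i, ∑ j, ∑ k, ∑ l, G⁻¹ i k * G⁻¹ j l * A i j * A k l
      = ((G⁻¹.transpose * A * G⁻¹).transpose * A).trace := by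
    simp only [Matrix.trace, Matrix.diag, Matrix.mul_apply, Matrix.transpose_apply,
      Finset.sum_mul]
    calc _ = ∑ l, ∑ k, ∑ j, ∑ i, G⁻¹ i k * G⁻¹ j l * A i j * A k l := by
          rw [Finset.sum_congr rfl fun i _ => Finset.sum_comm]
          rw [Finset.sum_comm]
          rw [Finset.sum_congr rfl fun i _ => Finset.sum_congr rfl fun j _ => Finset.sum_comm]
          rw [Finset.sum_congr rfl fun i _ => Finset.sum_comm]
          rw [Finset.sum_comm]
          refine Finset.sum_congr rfl fun i _ => Finset.sum_congr rfl fun j _ => ?_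
          rw [Finset.sum_comm]
      _ = _ := by
          refine Finset.sum_congr rfl fun i _ => Finset.sum_congr rfl fun j _ =>
            Finset.sum_congr rfl fun k _ => Finset.sum_congr rfl fun l _ => ?_
          ring
  have h2 : (G⁻¹.transpose * A * G⁻¹).transpose * A
      = E * ((E.transpose * A * E).transpose * E.transpose * A) := by
    rw [inv_eq_mul_transpose hG]
    simp only [Matrix.transpose_mul, Matrix.transpose_transpose, Matrix.mul_assoc]
  rw [h1, h2, Matrix.trace_mul_comm,
    show (E.transpose * A * E).transpose * E.transpose * A * E
      = (E.transpose * A * E).transpose * (E.transpose * A * E) by simp only [Matrix.mul_assoc],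
    hA, Matrix.diagonal_transpose, Matrix.diagonal_mul_diagonal, Matrix.trace_diagonal]
  simp only [sq]

lemma sum_sq_add_P2 (x : Fin n → ℝ) : (∑ i, x i) ^ 2 = ∑ i, x i ^ 2 + 2 * P2 x := by
  have h : ∀ i, ∑ j, x i * x j
      = x i ^ 2 + ∑ j ∈ Finset.Ioi i, x i * x j + ∑ j ∈ Finset.Iio i, x i * x j := by
    intro i
    have hu : (Finset.univ : Finset (Fin n)) = insert i (Finset.Ioi i ∪ Finset.Iio i) := by
      ext j; simp; grind
    rw [hu, Finset.sum_insert (by simp), Finset.sum_union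
      (Finset.disjoint_left.2 fun j h1 h2 => by
        simp only [Finset.mem_Ioi, Finset.mem_Iio] at h1 h2; grind)]
    ring
  have hsw : ∑ i, ∑ j ∈ Finset.Iio i, x i * x j = P2 x := by
    rw [P2, Finset.sum_comm' (t' := Finset.univ) (s' := fun j => Finset.Ioi j) (by simp)]
    exact Finset.sum_congr rfl fun i _ => Finset.sum_congr rfl fun j _ => mul_comm _ _
  rw [sq, Finset.sum_mul_sum, Finset.sum_congr rfl fun i _ => h i, Finset.sum_add_distrib,
    Finset.sum_add_distrib, hsw, ← P2]
  ring

lemma P2_pos_of_mem_Gamma2 {x : Fin n → ℝ} (h : x ∈ Gamma2 n) : 0 < P2 x :=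
  (connectedComponentIn_subset {x : Fin n → ℝ | 0 < P2 x} _ h :)

/-- On `{P2 > 0}` the square of the sum is at least `2 P2 > 0`, so the sum never vanishes there; by
connectedness it keeps the sign that it has at `(1, …, 1)`. -/
lemma sum_pos_of_mem_Gamma2 {x : Fin n → ℝ} (h : x ∈ Gamma2 n) : 0 < ∑ i, x i := by
  have h1 : (fun _ => 1 : Fin n → ℝ) ∈ {x : Fin n → ℝ | 0 < P2 x} :=
    connectedComponentIn_nonempty_iff.1 ⟨x, h⟩
  by_contra hx
  push Not at hx
  have hpre : IsPreconnected (Gamma2 n) := isPreconnected_connectedComponentIn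
  have hc : ContinuousOn (fun z : Fin n → ℝ => ∑ i, z i) (Gamma2 n) :=
    (by fun_prop : Continuous fun z : Fin n → ℝ => ∑ i, z i).continuousOn
  have h0 : (0 : ℝ) ∈ Set.Icc (∑ i, x i) (∑ i : Fin n, (1 : ℝ)) := ⟨hx, by simp⟩
  obtain ⟨z, hz, hz0⟩ := hpre.intermediate_value h (mem_connectedComponentIn h1) hc h0
  have hp := P2_pos_of_mem_Gamma2 hz
  have hs := sum_sq_add_P2 z
  have : 0 ≤ ∑ i, z i ^ 2 := Finset.sum_nonneg fun i _ => sq_nonneg _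
  simp only at hz0
  rw [hz0] at hs
  linarith

/-- Since `xᵢ² ≤ ∑ xⱼ² ≤ (∑ xⱼ)²`. This is ellipticity: the numbers `H - λᵢ` are the coefficients of
the linearization of `σ₂`. -/
lemma le_sum_of_mem_Gamma2 {x : Fin n → ℝ} (h : x ∈ Gamma2 n) (i : Fin n) :
    x i ≤ ∑ j, x j := by
  have h1 := sum_sq_add_P2 x
  have h2 := P2_pos_of_mem_Gamma2 h
  have h3 := sum_pos_of_mem_Gamma2 h
  have h4 : x i ^ 2 ≤ ∑ j, x j ^ 2 :=
    Finset.single_le_sum (f := fun j => x j ^ 2) (fun j _ => sq_nonneg _) (Finset.mem_univ i)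
  exact (le_abs_self _).trans (abs_le_of_sq_le_sq (by linarith) h3.le)

/-- `H tr A³ - |A|⁴ ≤ P₂ |A|²` on `Γ₂`. -/
lemma sum_mul_sum_cube_le {x : Fin n → ℝ} (h : x ∈ Gamma2 n) :
    (∑ i, x i) * ∑ i, x i ^ 3 - (∑ i, x i ^ 2) ^ 2 ≤ P2 x * ∑ i, x i ^ 2 := by
  have h1 := sum_sq_add_P2 x
  have h2 := P2_pos_of_mem_Gamma2 h
  have h3 := sum_pos_of_mem_Gamma2 h
  set N := ∑ i, x i ^ 2 with hN
  have hN0 : 0 ≤ N := Finset.sum_nonneg fun i _ => sq_nonneg _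
  set a := Real.sqrt N with ha
  have ha2 : a ^ 2 = N := Real.sq_sqrt hN0
  have ha0 : 0 ≤ a := Real.sqrt_nonneg _
  have h4 : ∑ i, x i ^ 3 ≤ a * N := by
    rw [hN, Finset.mul_sum]
    refine Finset.sum_le_sum fun i _ => ?_
    have h5 : x i ≤ a := Real.le_sqrt_of_sq_le
      (Finset.single_le_sum (f := fun j => x j ^ 2) (fun j _ => sq_nonneg _) (Finset.mem_univ i))
    nlinarith [mul_le_mul_of_nonneg_right h5 (sq_nonneg (x i))]
  set H := ∑ i, x i
  have h6 : H * ∑ i, x i ^ 3 ≤ H * (a * N) := mul_le_mul_of_nonneg_left h4 h3.le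
  -- With `a = |x|`, the difference `P2 - a (H - a) = (H² - a²)/2 - a (H - a)` equals `(H - a)²/2`.
  have h7 : a * (H - a) ≤ P2 x := by nlinarith [sq_nonneg (H - a)]
  nlinarith [mul_le_mul_of_nonneg_right h7 hN0]

end PrincipalCurvatures

/-! ### Decomposition along the moving frame -/

section Frame

variable {n : ℕ}

/-- Decomposition of a vector of Minkowski space with respect to the frame consisting of tangent
vectors `b`, a timelike unit normal `ν`, and a position vector `x`. -/
lemma frame_decomposition {ρ : ℝ} (hρ : ρ ≠ 0) {b : Fin n → Mink n} {ν x : Mink n}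
    {G : Matrix (Fin n) (Fin n) ℝ} (hG : ∀ i j, G i j = mink (b i) (b j)) (hdet : G.det ≠ 0)
    (hνb : ∀ i, mink ν (b i) = 0) (hxb : ∀ i, mink x (b i) = 0) (hνx : mink ν x = 0)
    (hν : mink ν ν = -1) (hx : mink x x = ρ ^ 2) (v : Mink n) :
    v = ∑ i, (∑ m, G⁻¹ i m * mink v (b m)) • b i - mink v ν • ν
      + (ρ⁻¹ ^ 2 * mink v x) • x := by
  have hGi : G * G⁻¹ = 1 := Matrix.mul_nonsing_inv _ (isUnit_iff_ne_zero.2 hdet)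
  have hGs : ∀ i j, G i j = G j i := fun i j => by rw [hG, hG, mink_comm]
  -- The `n + 2` frame vectors are independent because their Gram matrix is block diagonal and
  -- nondegenerate, so by dimension they span; the remainder `v - r` is orthogonal to all of them
  -- and vanishes by nondegeneracy.
  let w : Fin n ⊕ Fin 2 → Mink n := Sum.elim b ![ν, x]
  have hw : LinearIndependent ℝ w := by
    rw [Fintype.linearIndependent_iff]
    intro c hc
    simp only [Fintype.sum_sum_type, Fin.sum_univ_two, w, Sum.elim_inl, Sum.elim_inr,
      Matrix.cons_val_zero, Matrix.cons_val_one] at hc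
    have pair : ∀ u, ∑ i, c (.inl i) * mink u (b i)
        + (c (.inr 0) * mink u ν + c (.inr 1) * mink u x) = 0 := by
      intro u
      have := congrArg (mink u) hc
      simpa only [mink_add_right, mink_sum_right, mink_smul_right, mink_zero_right] using this
    have c0 : c (.inr 0) = 0 := by
      have := pair ν
      simpa [hνb, hν, hνx] using this
    have c1 : c (.inr 1) = 0 := by
      have := pair x
      simpa [hxb, hx, c0, hρ] using this
    have cb : (fun i => c (.inl i)) = 0 := by
      refine Matrix.eq_zero_of_mulVec_eq_zero hdet (funext fun j => ?_)
      have := pair (b j)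
      simp only [c0, c1, zero_mul, add_zero] at this
      rw [Matrix.mulVec, dotProduct, Pi.zero_apply, ← this]
      exact Finset.sum_congr rfl fun i _ => by rw [hG, mul_comm]
    rintro (i | i)
    · exact congrFun cb i
    · fin_cases i
      · exact c0
      · exact c1
  have hspan : Submodule.span ℝ (Set.range w) = ⊤ :=
    hw.span_eq_top_of_card_eq_finrank (by simp)
  set r := ∑ i, (∑ m, G⁻¹ i m * mink v (b m)) • b i - mink v ν • ν + (ρ⁻¹ ^ 2 * mink v x) • x
    with hr
  have horth : ∀ a, mink (v - r) (w a) = 0 := by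
    rintro (j | a)
    · have : ∑ i, (∑ m, G⁻¹ i m * mink v (b m)) * mink (b i) (b j) = mink v (b j) := by
        simp_rw [Finset.sum_mul]
        rw [Finset.sum_comm]
        calc _ = ∑ m, (G * G⁻¹) j m * mink v (b m) := by
              refine Finset.sum_congr rfl fun m _ => ?_
              rw [Matrix.mul_apply, Finset.sum_mul]
              refine Finset.sum_congr rfl fun i _ => ?_
              rw [← hG, hGs i j]; ring
          _ = _ := by simp [hGi, Matrix.one_apply]
      simp only [w, Sum.elim_inl, hr, mink_sub_left, mink_add_left, mink_sum_left, mink_smul_left,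
        this, hνb, hxb]
      ring
    · have hbν : ∀ i, mink (b i) ν = 0 := fun i => by rw [mink_comm, hνb]
      have hbx : ∀ i, mink (b i) x = 0 := fun i => by rw [mink_comm, hxb]
      have hxν : mink x ν = 0 := by rw [mink_comm, hνx]
      fin_cases a
      · simp [w, hr, mink_sub_left, mink_add_left, mink_sum_left, mink_smul_left, hbν, hν, hxν]
      · simp only [w, Fin.mk_one, Sum.elim_inr, Matrix.cons_val_one, hr, mink_sub_left,
          mink_add_left, mink_sum_left, mink_smul_left, hbx, hνx, hx, Matrix.cons_val_fin_one]
        field_simp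
        simp
  have hzero : v - r = 0 := by
    refine eq_zero_of_mink_eq_zero fun u => ?_
    have hu : u ∈ Submodule.span ℝ (Set.range w) := by rw [hspan]; trivial
    induction hu using Submodule.span_induction with
    | mem u h => obtain ⟨a, rfl⟩ := h; exact horth a
    | zero => exact mink_zero_right _
    | add p q _ _ hp hq => rw [mink_add_right, hp, hq, add_zero]
    | smul c p _ hp => rw [mink_smul_right, hp, mul_zero]
  exact sub_eq_zero.1 hzero

end Frame

/-! ### Smoothness of determinant and inverse -/

section MatrixSmooth

variable {n : ℕ} {k : ℕ∞ω} {y : Coord n}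

lemma contDiffAt_det {M : Coord n → Matrix (Fin n) (Fin n) ℝ}
    (h : ∀ i j, ContDiffAt ℝ k (fun z => M z i j) y) : ContDiffAt ℝ k (fun z => (M z).det) y := by
  simp only [Matrix.det_apply, Units.smul_def, zsmul_eq_mul]
  exact ContDiffAt.sum fun σ _ => contDiffAt_const.mul (contDiffAt_prod fun i _ => h _ _)

/-- By Cramer's rule, each entry is a quotient of determinants. -/
lemma contDiffAt_inv {M : Coord n → Matrix (Fin n) (Fin n) ℝ}
    (h : ∀ i j, ContDiffAt ℝ k (fun z => M z i j) y) (hdet : (M y).det ≠ 0) (i j : Fin n) :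
    ContDiffAt ℝ k (fun z => (M z)⁻¹ i j) y := by
  have e : (fun z => (M z)⁻¹ i j)
      = fun z => ((M z).det)⁻¹ * ((M z).updateRow j (Pi.single i 1)).det := by
    funext z
    rw [Matrix.inv_def, Matrix.smul_apply, Matrix.adjugate_apply, Ring.inverse_eq_inv', smul_eq_mul]
  rw [e]
  refine ((contDiffAt_det h).inv hdet).mul (contDiffAt_det fun a b => ?_)
  by_cases ha : a = j
  · subst ha
    simp only [Matrix.updateRow_self]
    exact contDiffAt_const
  · simp only [Matrix.updateRow_ne ha]
    exact h a b

end MatrixSmooth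

/-! ### Local hypersurface geometry in de Sitter space: Weingarten, Gauss formula, Gauss equations
-/

section Hypersurface

variable {n : ℕ}

/-- First fundamental form of a parametrized spacelike submanifold. -/
noncomputable def metricOf (Y : Coord n → Mink n) (y : Coord n) : Matrix (Fin n) (Fin n) ℝ :=
  Matrix.of fun i j => mink (partialD i Y y) (partialD j Y y)

/-- Second fundamental form with respect to the normal `ν`. -/
noncomputable def sffOf (Y ν : Coord n → Mink n) (y : Coord n) : Matrix (Fin n) (Fin n) ℝ :=
  Matrix.of fun i j => mink (ν y) (partialD i (partialD j Y) y)

/-- The shape operator. -/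
noncomputable def shapeOf (Y ν : Coord n → Mink n) (y : Coord n) : Matrix (Fin n) (Fin n) ℝ :=
  (metricOf Y y)⁻¹ * sffOf Y ν y

/-- The mean curvature. -/
noncomputable def meanOf (Y ν : Coord n → Mink n) (y : Coord n) : ℝ := (shapeOf Y ν y).trace

/-- The second elementary symmetric polynomial of the principal curvatures. -/
noncomputable def sigmaOf (Y ν : Coord n → Mink n) (y : Coord n) : ℝ :=
  ((shapeOf Y ν y).trace ^ 2 - (shapeOf Y ν y * shapeOf Y ν y).trace) / 2

/-- A smooth map into de Sitter space together with a smooth timelike unit normal field. -/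
structure HasUnitNormal (ρ : ℝ) (Y ν : Coord n → Mink n) : Prop where
  smooth : ContDiff ℝ ∞ Y
  smooth_normal : ContDiff ℝ ∞ ν
  mink_self : ∀ y, mink (Y y) (Y y) = ρ ^ 2
  normal_position : ∀ y, mink (ν y) (Y y) = 0
  normal_tangent : ∀ y i, mink (ν y) (partialD i Y y) = 0
  normal_self : ∀ y, mink (ν y) (ν y) = -1

lemma metricOf_symm (Y : Coord n → Mink n) (y : Coord n) (i j : Fin n) :
    metricOf Y y i j = metricOf Y y j i := mink_comm _ _

lemma contDiff_metricOf {Y : Coord n → Mink n} (hY : ContDiff ℝ ∞ Y) (i j : Fin n) :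
    ContDiff ℝ ∞ (fun y => metricOf Y y i j) :=
  ContDiff.mink (ContDiff.partialD hY i) (ContDiff.partialD hY j)

lemma smooth_two {F : Type*} [NormedAddCommGroup F] [NormedSpace ℝ F] {f : Coord n → F}
    (h : ContDiff ℝ ∞ f) (y : Coord n) : ContDiffAt ℝ 2 f y :=
  h.contDiffAt.of_le (WithTop.coe_le_coe.2 le_top)

lemma smooth_diff {F : Type*} [NormedAddCommGroup F] [NormedSpace ℝ F] {f : Coord n → F}
    (h : ContDiff ℝ ∞ f) (y : Coord n) : DifferentiableAt ℝ f y :=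
  h.contDiffAt.differentiableAt (by simp)

/-- A timelike unit normal field of a fixed time orientation is smooth. -/
lemma contDiff_normal {ρ : ℝ} (hρ : ρ ≠ 0) {Y ν : Coord n → Mink n} (hY : ContDiff ℝ ∞ Y)
    (hdet : ∀ y, (metricOf Y y).det ≠ 0) (hYY : ∀ y, mink (Y y) (Y y) = ρ ^ 2)
    (hYt : ∀ y i, mink (Y y) (partialD i Y y) = 0)
    (hνY : ∀ y, mink (ν y) (Y y) = 0) (hνt : ∀ y i, mink (ν y) (partialD i Y y) = 0)
    (hνν : ∀ y, mink (ν y) (ν y) = -1) (hdown : ∀ y, ν y 0 < 0) : ContDiff ℝ ∞ ν := by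
  rw [contDiff_iff_contDiffAt]
  intro y₀
  -- `N y` is the projection of the fixed vector `ν y₀` onto the normal line at `y`. It is smooth in
  -- `y`, and `ν` is recovered from it near `y₀` by normalization, the time orientation fixing the
  -- sign.
  set N : Coord n → Mink n := fun y => ν y₀
    - ∑ i, (∑ m, (metricOf Y y)⁻¹ i m * mink (ν y₀) (partialD m Y y)) • partialD i Y y
    - (ρ⁻¹ ^ 2 * mink (ν y₀) (Y y)) • Y y with hN
  have hNν : ∀ y, N y = -(mink (ν y₀) (ν y)) • ν y := by
    intro y
    have h1 : ν y₀
        = ∑ i, (∑ m, (metricOf Y y)⁻¹ i m * mink (ν y₀) (partialD m Y y)) • partialD i Y y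
          - mink (ν y₀) (ν y) • ν y + (ρ⁻¹ ^ 2 * mink (ν y₀) (Y y)) • Y y :=
      frame_decomposition hρ (fun i j => rfl) (hdet y) (hνt y) (hYt y) (hνY y) (hνν y)
        (hYY y) (ν y₀)
    have h2 : N y = ν y₀
      - ∑ i, (∑ m, (metricOf Y y)⁻¹ i m * mink (ν y₀) (partialD m Y y)) • partialD i Y y
      - (ρ⁻¹ ^ 2 * mink (ν y₀) (Y y)) • Y y := rfl
    rw [h2]
    linear_combination (norm := module) h1
  have hNs : ContDiffAt ℝ ∞ N y₀ := by
    have hp : ∀ i, ContDiffAt ℝ ∞ (partialD i Y) y₀ := fun i =>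
      (ContDiff.partialD hY i).contDiffAt
    refine (contDiffAt_const.sub (ContDiffAt.sum fun i _ => ?_)).sub ?_
    · refine ContDiffAt.fun_smul (ContDiffAt.sum fun m _ => ?_) (hp i)
      exact (contDiffAt_inv (fun a b => (contDiff_metricOf hY a b).contDiffAt) (hdet y₀) i m).mul
        (ContDiffAt.mink contDiffAt_const (hp m))
    · exact (contDiffAt_const.mul (ContDiffAt.mink contDiffAt_const hY.contDiffAt)).smul
        hY.contDiffAt
  have hN0 : N y₀ = ν y₀ := by rw [hNν, hνν]; simp
  have hneg : ∀ᶠ y in 𝓝 y₀, N y 0 < 0 := by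
    have hc : ContinuousAt (fun y => N y 0) y₀ := (continuous_apply 0).continuousAt.comp
      hNs.continuousAt
    exact hc.eventually_lt continuousAt_const (by simpa [hN0] using hdown y₀)
  have hsq : ∀ y, -mink (N y) (N y) = (mink (ν y₀) (ν y)) ^ 2 := by
    intro y
    rw [hNν, mink_smul_left, mink_smul_right, hνν]; ring
  have e : ν =ᶠ[𝓝 y₀] fun y => (Real.sqrt (-mink (N y) (N y)))⁻¹ • N y := by
    filter_upwards [hneg] with y hy
    rw [hNν] at hy
    -- `N y` and `ν y` both point to the past, so the factor `-⟨ν y₀, ν y⟩` between them is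
    -- positive.
    have hc : mink (ν y₀) (ν y) < 0 := by
      simp only [Pi.smul_apply, smul_eq_mul] at hy
      have := hdown y
      by_contra hcon
      push Not at hcon
      nlinarith
    rw [hsq, Real.sqrt_sq_eq_abs, abs_of_neg hc, hNν, smul_smul, inv_mul_cancel₀ (by linarith),
      one_smul]
  refine ContDiffAt.congr_of_eventuallyEq ?_ e
  have h1 : -mink (N y₀) (N y₀) = 1 := by rw [hN0, hνν]; simp
  refine ContDiffAt.smul (ContDiffAt.inv (ContDiffAt.sqrt (ContDiffAt.mink hNs hNs).neg ?_) ?_) hNs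
  · rw [h1]; norm_num
  · rw [h1]; norm_num

namespace HasUnitNormal

variable {ρ : ℝ} {Y ν : Coord n → Mink n}

lemma position_tangent (h : HasUnitNormal ρ Y ν) (y : Coord n) (i : Fin n) :
    mink (Y y) (partialD i Y y) = 0 := by
  have h1 := partialD_mink (smooth_diff h.smooth y) (smooth_diff h.smooth y) i
  simp only [h.mink_self, partialD_const] at h1
  rw [mink_comm] at h1
  linarith

lemma position_hess (h : HasUnitNormal ρ Y ν) (y : Coord n) (i j : Fin n) :
    mink (partialD i (partialD j Y) y) (Y y) = -metricOf Y y i j := by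
  have h1 := partialD_mink (smooth_diff h.smooth y)
    (smooth_diff (ContDiff.partialD h.smooth j) y) i
  simp only [h.position_tangent, partialD_const] at h1
  rw [mink_comm, metricOf, Matrix.of_apply]
  linarith

lemma deriv_normal_tangent (h : HasUnitNormal ρ Y ν) (y : Coord n) (i j : Fin n) :
    mink (partialD i ν y) (partialD j Y y) = -sffOf Y ν y i j := by
  have h1 := partialD_mink (smooth_diff h.smooth_normal y)
    (smooth_diff (ContDiff.partialD h.smooth j) y) i
  simp only [h.normal_tangent, partialD_const] at h1
  rw [sffOf, Matrix.of_apply]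
  linarith

lemma deriv_normal_normal (h : HasUnitNormal ρ Y ν) (y : Coord n) (i : Fin n) :
    mink (partialD i ν y) (ν y) = 0 := by
  have h1 := partialD_mink (smooth_diff h.smooth_normal y) (smooth_diff h.smooth_normal y) i
  simp only [h.normal_self, partialD_const] at h1
  rw [mink_comm (ν y)] at h1
  linarith

lemma deriv_normal_position (h : HasUnitNormal ρ Y ν) (y : Coord n) (i : Fin n) :
    mink (partialD i ν y) (Y y) = 0 := by
  have h1 := partialD_mink (smooth_diff h.smooth_normal y) (smooth_diff h.smooth y) i
  simp only [h.normal_position, partialD_const, h.normal_tangent] at h1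
  linarith

lemma sff_symm (h : HasUnitNormal ρ Y ν) (y : Coord n) (i j : Fin n) :
    sffOf Y ν y i j = sffOf Y ν y j i := by
  simp only [sffOf, Matrix.of_apply]
  rw [partialD_comm (smooth_two h.smooth y)]

lemma contDiff_sff (h : HasUnitNormal ρ Y ν) (i j : Fin n) :
    ContDiff ℝ ∞ (fun y => sffOf Y ν y i j) :=
  ContDiff.mink h.smooth_normal (ContDiff.partialD (ContDiff.partialD h.smooth j) i)

lemma contDiffAt_shape (h : HasUnitNormal ρ Y ν) {y : Coord n} (hdet : (metricOf Y y).det ≠ 0)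
    (i j : Fin n) : ContDiffAt ℝ ∞ (fun z => shapeOf Y ν z i j) y := by
  simp only [shapeOf, Matrix.mul_apply]
  exact ContDiffAt.sum fun m _ =>
    (contDiffAt_inv (fun a b => (contDiff_metricOf h.smooth a b).contDiffAt) hdet i m).mul
      (h.contDiff_sff m j).contDiffAt

lemma contDiffAt_mean (h : HasUnitNormal ρ Y ν) {y : Coord n} (hdet : (metricOf Y y).det ≠ 0) :
    ContDiffAt ℝ ∞ (meanOf Y ν) y := by
  have e : meanOf Y ν = fun z => ∑ i, shapeOf Y ν z i i := rfl
  rw [e]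
  exact ContDiffAt.sum fun i _ => h.contDiffAt_shape hdet i i

lemma contDiffAt_sigma (h : HasUnitNormal ρ Y ν) {y : Coord n} (hdet : (metricOf Y y).det ≠ 0) :
    ContDiffAt ℝ ∞ (sigmaOf Y ν) y := by
  have e : sigmaOf Y ν = fun z => (meanOf Y ν z ^ 2
      - ∑ i, ∑ j, shapeOf Y ν z i j * shapeOf Y ν z j i) * (2 : ℝ)⁻¹ := by
    funext z
    simp only [sigmaOf, meanOf, Matrix.trace, Matrix.diag, Matrix.mul_apply, div_eq_mul_inv]
  rw [e]
  exact (((h.contDiffAt_mean hdet).pow 2).sub (ContDiffAt.sum fun i _ => ContDiffAt.sum fun j _ =>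
    (h.contDiffAt_shape hdet i j).mul (h.contDiffAt_shape hdet j i))).mul contDiffAt_const

end HasUnitNormal

lemma partialD_metricOf {Y : Coord n → Mink n} (hY : ContDiff ℝ ∞ Y) (y : Coord n)
    (k i j : Fin n) : partialD k (fun z => metricOf Y z i j) y
      = mink (partialD k (partialD i Y) y) (partialD j Y y)
        + mink (partialD i Y y) (partialD k (partialD j Y) y) :=
  partialD_mink (smooth_diff (ContDiff.partialD hY i) y) (smooth_diff (ContDiff.partialD hY j) y) k

/-- When the metric is induced, the three metric derivatives combine so that only the tangential
part of the Hessian of `Y` survives; this makes the Christoffel symbols the tangential coefficients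
in the Gauss formula. -/
lemma christoffel_metricOf {Y : Coord n → Mink n} (hY : ContDiff ℝ ∞ Y) (k i j : Fin n)
    (y : Coord n) : christoffel (metricOf Y) k i j y
      = ∑ l, (metricOf Y y)⁻¹ k l * mink (partialD i (partialD j Y) y) (partialD l Y y) := by
  rw [christoffel, Finset.mul_sum]
  refine Finset.sum_congr rfl fun l _ => ?_
  simp only [partialD_metricOf hY]
  rw [partialD_comm (smooth_two hY y) j i, partialD_comm (smooth_two hY y) i l,
    partialD_comm (smooth_two hY y) j l, mink_comm (partialD j Y y), mink_comm (partialD i Y y)]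
  ring

lemma christoffel_metricOf_symm {Y : Coord n → Mink n} (hY : ContDiff ℝ ∞ Y) (k i j : Fin n)
    (y : Coord n) : christoffel (metricOf Y) k i j y = christoffel (metricOf Y) k j i y := by
  rw [christoffel_metricOf hY, christoffel_metricOf hY, partialD_comm (smooth_two hY y)]

lemma contDiffAt_christoffel {Y : Coord n → Mink n} (hY : ContDiff ℝ ∞ Y) {y : Coord n}
    (hdet : (metricOf Y y).det ≠ 0) (k i j : Fin n) :
    ContDiffAt ℝ ∞ (christoffel (metricOf Y) k i j) y := by
  have e : christoffel (metricOf Y) k i j = fun z =>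
      ∑ l, (metricOf Y z)⁻¹ k l * mink (partialD i (partialD j Y) z) (partialD l Y z) :=
    funext fun z => christoffel_metricOf hY k i j z
  rw [e]
  exact ContDiffAt.sum fun l _ =>
    (contDiffAt_inv (fun a b => (contDiff_metricOf hY a b).contDiffAt) hdet k l).mul
      (ContDiff.mink (ContDiff.partialD (ContDiff.partialD hY j) i)
        (ContDiff.partialD hY l)).contDiffAt

namespace HasUnitNormal

variable {ρ : ℝ} {Y ν : Coord n → Mink n}

/-- The Gauss formula. -/
lemma gauss_formula (h : HasUnitNormal ρ Y ν) (hρ : ρ ≠ 0) {y : Coord n}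
    (hdet : (metricOf Y y).det ≠ 0) (i j : Fin n) :
    partialD i (partialD j Y) y = ∑ k, christoffel (metricOf Y) k i j y • partialD k Y y
      - sffOf Y ν y i j • ν y - (ρ⁻¹ ^ 2 * metricOf Y y i j) • Y y := by
  have := frame_decomposition hρ (G := metricOf Y y) (fun i j => rfl) hdet (h.normal_tangent y)
    (h.position_tangent y) (h.normal_position y) (h.normal_self y) (h.mink_self y) (partialD i (partialD j Y) y)
  rw [h.position_hess, mink_comm _ (ν y)] at this
  simp only [← christoffel_metricOf h.smooth] at this
  rw [this, sffOf, Matrix.of_apply]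
  module

/-- The Gauss equation for the curvature operator. -/
lemma riemann_eq (h : HasUnitNormal ρ Y ν) (hρ : ρ ≠ 0) (hdet : ∀ y, (metricOf Y y).det ≠ 0)
    (l k i j : Fin n) (y : Coord n) :
    riemann (metricOf Y) l k i j y
      = ρ⁻¹ ^ 2 * (metricOf Y y j k * (if l = i then 1 else 0)
          - metricOf Y y i k * (if l = j then 1 else 0))
        - (sffOf Y ν y j k * shapeOf Y ν y l i - sffOf Y ν y i k * shapeOf Y ν y l j) := by
  -- `T` reads off the coefficient of `∂ₗY` in the frame. Applying it to the differentiated Gauss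
  -- formula and using that third derivatives of `Y` commute gives the Gauss equation.
  set T : Mink n → ℝ := fun v => ∑ m, (metricOf Y y)⁻¹ l m * mink v (partialD m Y y) with hT
  have Tadd : ∀ u v, T (u + v) = T u + T v := fun u v => by
    simp only [hT, mink_add_left, mul_add, Finset.sum_add_distrib]
  have Tsub : ∀ u v, T (u - v) = T u - T v := fun u v => by
    simp only [hT, mink_sub_left, mul_sub, Finset.sum_sub_distrib]
  have Tsmul : ∀ (c : ℝ) v, T (c • v) = c * T v := fun c v => by
    simp only [hT, mink_smul_left, Finset.mul_sum, mul_left_comm]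
  have Tsum : ∀ f : Fin n → Mink n, T (∑ m, f m) = ∑ m, T (f m) := fun f => by
    simp only [hT, mink_sum_left, Finset.mul_sum]
    rw [Finset.sum_comm]
  have Ttan : ∀ m, T (partialD m Y y) = if l = m then 1 else 0 := fun m => by
    have : ((metricOf Y y)⁻¹ * metricOf Y y) l m = T (partialD m Y y) := by
      rw [Matrix.mul_apply]
      exact Finset.sum_congr rfl fun a _ => by rw [metricOf_symm Y y a m]; rfl
    rw [← this, Matrix.nonsing_inv_mul _ (isUnit_iff_ne_zero.2 (hdet y)), Matrix.one_apply]
  have Tν : T (ν y) = 0 := by simp [hT, h.normal_tangent]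
  have TY : T (Y y) = 0 := by simp [hT, h.position_tangent]
  have Thess : ∀ a b, T (partialD a (partialD b Y) y) = christoffel (metricOf Y) l a b y :=
    fun a b => (christoffel_metricOf h.smooth l a b y).symm
  have Tdν : ∀ a, T (partialD a ν y) = -shapeOf Y ν y l a := fun a => by
    simp only [hT, h.deriv_normal_tangent, shapeOf, Matrix.mul_apply, mul_neg,
      Finset.sum_neg_distrib, h.sff_symm y a]
  have dΓ : ∀ m a b, DifferentiableAt ℝ (christoffel (metricOf Y) m a b) y := fun m a b =>
    (contDiffAt_christoffel h.smooth (hdet y) m a b).differentiableAt (by simp)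
  have dY : ∀ m, DifferentiableAt ℝ (partialD m Y) y := fun m =>
    smooth_diff (ContDiff.partialD h.smooth m) y
  have key : ∀ a b, T (partialD a (partialD b (partialD k Y)) y)
      = ∑ m, christoffel (metricOf Y) m b k y * christoffel (metricOf Y) l a m y
        + partialD a (christoffel (metricOf Y) l b k) y + sffOf Y ν y b k * shapeOf Y ν y l a
        - ρ⁻¹ ^ 2 * metricOf Y y b k * (if l = a then 1 else 0) := by
    intro a b
    have e : partialD b (partialD k Y) = fun z =>
        ∑ m, christoffel (metricOf Y) m b k z • partialD m Y z
          - sffOf Y ν z b k • ν z - (ρ⁻¹ ^ 2 * metricOf Y z b k) • Y z :=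
      funext fun z => h.gauss_formula hρ (hdet z) b k
    have dA := smooth_diff (h.contDiff_sff b k) y
    have dG := smooth_diff (contDiff_metricOf h.smooth b k) y
    have dν := smooth_diff h.smooth_normal y
    have dY0 := smooth_diff h.smooth y
    have dS : DifferentiableAt ℝ
        (fun z => ∑ m, christoffel (metricOf Y) m b k z • partialD m Y z) y :=
      DifferentiableAt.fun_sum fun m _ => (dΓ m b k).fun_smul (dY m)
    rw [e, partialD_sub (dS.fun_sub (dA.fun_smul dν)) ((dG.const_mul _).fun_smul dY0),
      partialD_sub dS (dA.fun_smul dν), partialD_sum _ fun m _ => (dΓ m b k).fun_smul (dY m),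
      partialD_smul dA dν, partialD_smul (dG.const_mul _) dY0]
    simp only [fun m => partialD_smul (dΓ m b k) (dY m), Tsub, Tadd, Tsmul, Tsum, Ttan, Tν, TY,
      Thess, Tdν, Finset.sum_add_distrib]
    simp
  have hsym := partialD_comm (smooth_two (ContDiff.partialD h.smooth k) y) i j
  have h1 := key i j
  rw [hsym, key j i] at h1
  rw [riemann, Finset.sum_sub_distrib]
  simp only [mul_comm (christoffel (metricOf Y) l _ _ y)]
  linarith

/-- The Gauss equation for the scalar curvature. -/
lemma scalar_eq (h : HasUnitNormal ρ Y ν) (hρ : ρ ≠ 0) (hdet : ∀ y, (metricOf Y y).det ≠ 0)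
    (y : Coord n) :
    scalar (metricOf Y) y = ρ⁻¹ ^ 2 * n * (n - 1) - 2 * sigmaOf Y ν y := by
  have hric : ∀ k j, ricci (metricOf Y) k j y = ρ⁻¹ ^ 2 * (n - 1) * metricOf Y y j k
      - meanOf Y ν y * sffOf Y ν y j k + ∑ i, sffOf Y ν y i k * shapeOf Y ν y i j := by
    intro k j
    simp only [ricci, h.riemann_eq hρ hdet, Finset.sum_sub_distrib, ← Finset.mul_sum]
    simp only [if_true, mul_one, mul_ite, mul_zero, Finset.sum_ite_eq', Finset.mem_univ,
      Finset.sum_const, Finset.card_univ, Fintype.card_fin, nsmul_eq_mul,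
      meanOf, Matrix.trace, Matrix.diag]
    ring
  set G := metricOf Y y with hG
  set A := sffOf Y ν y with hA
  set S := shapeOf Y ν y with hS
  have hSG : S = G⁻¹ * A := rfl
  have hGt : G.transpose = G := Matrix.ext fun i j => metricOf_symm Y y j i
  have hAt : A.transpose = A := Matrix.ext fun i j => h.sff_symm y j i
  have t1 : ∑ k, ∑ j, G⁻¹ k j * G j k = n := by
    have : (G⁻¹ * G).trace = n := by
      rw [Matrix.nonsing_inv_mul _ (isUnit_iff_ne_zero.2 (hdet y))]; simp
    simpa only [Matrix.trace, Matrix.diag, Matrix.mul_apply] using this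
  have t2 : ∑ k, ∑ j, G⁻¹ k j * A j k = S.trace := by
    simp only [hSG, Matrix.trace, Matrix.diag, Matrix.mul_apply]
  have t3 : ∑ k, ∑ j, G⁻¹ k j * ∑ i, A i k * S i j = (S * S).trace := by
    have hSt : S.transpose = A * G⁻¹ := by
      rw [hSG, Matrix.transpose_mul, Matrix.transpose_nonsing_inv, hGt, hAt]
    -- The matrix `S` itself need not be symmetric; symmetry of `G` and `A` only gives that the
    -- transpose of `S` is `A G⁻¹`.
    have : (S * S).trace = ((A * G⁻¹).transpose * S).trace := by
      rw [← hSt, Matrix.transpose_transpose]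
    rw [this]
    simp only [Matrix.trace, Matrix.diag, Matrix.mul_apply, Matrix.transpose_apply,
      Finset.mul_sum, Finset.sum_mul]
    rw [Finset.sum_comm]
    refine Finset.sum_congr rfl fun j _ => ?_
    rw [Finset.sum_comm]
    exact Finset.sum_congr rfl fun i _ => Finset.sum_congr rfl fun k _ => by ring
  have : scalar (metricOf Y) y = ρ⁻¹ ^ 2 * (n - 1) * ∑ k, ∑ j, G⁻¹ k j * G j k
      - meanOf Y ν y * ∑ k, ∑ j, G⁻¹ k j * A j k + ∑ k, ∑ j, G⁻¹ k j * ∑ i, A i k * S i j := by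
    simp only [scalar, hric, Finset.mul_sum, ← Finset.sum_sub_distrib, ← Finset.sum_add_distrib]
    refine Finset.sum_congr rfl fun k _ => Finset.sum_congr rfl fun j _ => ?_
    rw [mul_add, Finset.mul_sum]
    ring
  rw [this, t1, t2, t3, sigmaOf, meanOf]
  ring

end HasUnitNormal

/-- On surfaces, positive sectional curvature bounds `σ₂` from above. -/
lemma HasUnitNormal.sigma_lt_of_sectional_pos {ρ : ℝ} {Y ν : Coord 2 → Mink 2}
    (h : HasUnitNormal ρ Y ν) (hρ : ρ ≠ 0) (hdet : ∀ y, 0 < (metricOf Y y).det) (y : Coord 2)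
    (hsec : 0 < sectionalNum (metricOf Y) y ![1, 0] ![0, 1]) : sigmaOf Y ν y < ρ⁻¹ ^ 2 := by
  have hd := hdet y
  have hd' : (metricOf Y y).det ≠ 0 := hd.ne'
  simp only [sectionalNum, h.riemann_eq hρ (fun y => (hdet y).ne'), sigmaOf, shapeOf,
    Matrix.trace, Matrix.diag,
    Matrix.mul_apply, Fin.sum_univ_two] at hsec ⊢
  have hsG := metricOf_symm Y y 1 0
  have hsA := h.sff_symm y 1 0
  simp only [Matrix.inv_def, Ring.inverse_eq_inv', Matrix.smul_apply, Matrix.adjugate_fin_two,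
    smul_eq_mul] at hsec ⊢
  simp only [Matrix.det_fin_two] at hd hd' hsec ⊢
  simp [hsG, hsA] at hsec hd hd' ⊢
  set a := metricOf Y y 0 0
  set b := metricOf Y y 0 1
  set c := metricOf Y y 1 1
  set p := sffOf Y ν y 0 0
  set q := sffOf Y ν y 0 1
  set r := sffOf Y ν y 1 1
  -- The inverse determinant becomes an opaque variable `e` with `e det G = 1`, so that the Gauss
  -- equation `K det G = ρ⁻² det G - det A` reduces to polynomial identities.
  obtain ⟨e, he⟩ : ∃ e, e = (a * c - b * b)⁻¹ := ⟨_, rfl⟩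
  have he1 : e * (a * c - b * b) = 1 := by rw [he]; exact inv_mul_cancel₀ hd'
  have he0 : 0 < e := by rw [he]; exact inv_pos.2 (by linarith)
  rw [← he] at hsec ⊢
  have h1 : 0 < (ρ ^ 2)⁻¹ * (a * c - b * b) - (p * r - q * q) := by
    refine hsec.trans_eq ?_
    linear_combination -(p * r - q * q) * he1
  have h2 := mul_pos he0 h1
  rw [← sub_pos]
  refine h2.trans_eq ?_
  linear_combination ((ρ ^ 2)⁻¹ + e * (p * r - q * q)) * he1

end Hypersurface

/-! ### Simons' identity and the inequality for `σ₂` in adapted coordinates -/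

section Simons

variable {n : ℕ}

lemma partialD_comm_fun {F : Type*} [NormedAddCommGroup F] [NormedSpace ℝ F] {f : Coord n → F}
    (h : ContDiff ℝ ∞ f) (i j : Fin n) :
    partialD i (partialD j f) = partialD j (partialD i f) :=
  funext fun y => partialD_comm (smooth_two h y) i j

lemma partialD_partialD_add {f g : Coord n → ℝ} {y : Coord n} (hf : ContDiffAt ℝ 2 f y)
    (hg : ContDiffAt ℝ 2 g y) (i j : Fin n) :
    partialD i (partialD j (fun z => f z + g z)) y
      = partialD i (partialD j f) y + partialD i (partialD j g) y := by
  have := partialD_partialD_sum (Finset.univ : Finset (Fin 2)) (f := ![f, g]) (y := y)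
    (fun a _ => by fin_cases a <;> assumption) i j
  simpa [Fin.sum_univ_two] using this

lemma partialD_partialD_const_mul {f : Coord n → ℝ} {y : Coord n} (c : ℝ)
    (hf : ContDiffAt ℝ 2 f y) (i j : Fin n) :
    partialD i (partialD j (fun z => c * f z)) y = c * partialD i (partialD j f) y := by
  rw [partialD_partialD_mul contDiffAt_const hf, show partialD j (fun _ : Coord n => c)
    = fun _ => 0 from funext fun z => partialD_const _ _ _, partialD_const, partialD_const]
  ring

lemma partialD_partialD_mink {f g : Coord n → Mink n} (hf : ContDiff ℝ ∞ f)
    (hg : ContDiff ℝ ∞ g) (y : Coord n) (i : Fin n) :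
    partialD i (partialD i (fun z => mink (f z) (g z))) y
      = mink (partialD i (partialD i f) y) (g y) + 2 * mink (partialD i f y) (partialD i g y)
        + mink (f y) (partialD i (partialD i g) y) := by
  have hf' := ContDiff.partialD hf i
  have hg' := ContDiff.partialD hg i
  have e : partialD i (fun z => mink (f z) (g z))
      = fun z => mink (partialD i f z) (g z) + mink (f z) (partialD i g z) :=
    funext fun z => partialD_mink (smooth_diff hf z) (smooth_diff hg z) i
  rw [e, partialD_add (smooth_diff (ContDiff.mink hf' hg) y)
    (smooth_diff (ContDiff.mink hf hg') y),
    partialD_mink (smooth_diff hf' y) (smooth_diff hg y),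
    partialD_mink (smooth_diff hf y) (smooth_diff hg' y)]
  ring

/-- `Y` is parametrized at `y` by coordinates that are normal to first order and adapted to the
principal directions with principal curvatures `lam`. -/
structure IsPrincipalNormalAt (Y ν : Coord n → Mink n) (y : Coord n) (lam : Fin n → ℝ) :
    Prop where
  metric_eq : metricOf Y y = 1
  sff_eq : sffOf Y ν y = Matrix.diagonal lam
  hess_tangent : ∀ i j l, mink (partialD i (partialD j Y) y) (partialD l Y y) = 0

variable {ρ : ℝ} {Y ν : Coord n → Mink n} {y : Coord n} {lam : Fin n → ℝ}

namespace IsPrincipalNormalAt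

lemma det_ne_zero (hp : IsPrincipalNormalAt Y ν y lam) : (metricOf Y y).det ≠ 0 := by
  rw [hp.metric_eq, Matrix.det_one]; exact one_ne_zero

lemma shape_eq (hp : IsPrincipalNormalAt Y ν y lam) : shapeOf Y ν y = Matrix.diagonal lam := by
  rw [shapeOf, hp.metric_eq, hp.sff_eq]; simp

lemma partialD_metric (hp : IsPrincipalNormalAt Y ν y lam) (hY : ContDiff ℝ ∞ Y)
    (k i j : Fin n) : partialD k (fun z => metricOf Y z i j) y = 0 := by
  rw [partialD_metricOf hY, hp.hess_tangent, mink_comm, hp.hess_tangent, add_zero]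

lemma hess_eq (hp : IsPrincipalNormalAt Y ν y lam) (h : HasUnitNormal ρ Y ν) (hρ : ρ ≠ 0)
    (i j : Fin n) : partialD i (partialD j Y) y
      = -(Matrix.diagonal lam i j) • ν y
        - (ρ⁻¹ ^ 2 * (1 : Matrix (Fin n) (Fin n) ℝ) i j) • Y y := by
  rw [h.gauss_formula hρ hp.det_ne_zero, hp.sff_eq, hp.metric_eq]
  have : ∀ k, christoffel (metricOf Y) k i j y = 0 := fun k => by
    simp [christoffel_metricOf h.smooth, hp.hess_tangent]
  simp [this]

lemma deriv_normal_eq (hp : IsPrincipalNormalAt Y ν y lam) (h : HasUnitNormal ρ Y ν) (hρ : ρ ≠ 0)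
    (k : Fin n) : partialD k ν y = -lam k • partialD k Y y := by
  have h1 : partialD k ν y
      = ∑ i, (∑ m, (metricOf Y y)⁻¹ i m * mink (partialD k ν y) (partialD m Y y)) • partialD i Y y
        - mink (partialD k ν y) (ν y) • ν y + (ρ⁻¹ ^ 2 * mink (partialD k ν y) (Y y)) • Y y :=
    frame_decomposition hρ (fun i j => rfl) hp.det_ne_zero (h.normal_tangent y)
      (h.position_tangent y) (h.normal_position y) (h.normal_self y) (h.mink_self y) _
  rw [h.deriv_normal_normal, h.deriv_normal_position] at h1
  simp only [h.deriv_normal_tangent, hp.metric_eq, hp.sff_eq, inv_one, Matrix.one_apply] at h1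
  rw [h1]
  simp [Matrix.diagonal_apply]

end IsPrincipalNormalAt

/-- Differentiating this product relation gives the derivatives of the shape operator without
differentiating the inverse metric. -/
lemma HasUnitNormal.metric_mul_shape (h : HasUnitNormal ρ Y ν) (hdet : (metricOf Y y).det ≠ 0)
    (i j : Fin n) : (fun z => ∑ m, metricOf Y z i m * shapeOf Y ν z m j)
      =ᶠ[𝓝 y] fun z => sffOf Y ν z i j := by
  have hc : ContinuousAt (fun z => (metricOf Y z).det) y :=
    (contDiffAt_det (k := 0) fun a b =>
      ((contDiff_metricOf h.smooth a b).of_le (by simp)).contDiffAt).continuousAt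
  filter_upwards [hc.eventually_ne hdet] with z hz
  rw [← Matrix.mul_apply, shapeOf, ← Matrix.mul_assoc,
    Matrix.mul_nonsing_inv _ (isUnit_iff_ne_zero.2 hz), Matrix.one_mul]

namespace IsPrincipalNormalAt

lemma shape_two (hp : IsPrincipalNormalAt Y ν y lam) (h : HasUnitNormal ρ Y ν) (i j : Fin n) :
    ContDiffAt ℝ 2 (fun z => shapeOf Y ν z i j) y :=
  (h.contDiffAt_shape hp.det_ne_zero i j).of_le (WithTop.coe_le_coe.2 le_top)

lemma partialD_shape (hp : IsPrincipalNormalAt Y ν y lam) (h : HasUnitNormal ρ Y ν)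
    (k i j : Fin n) : partialD k (fun z => shapeOf Y ν z i j) y
      = partialD k (fun z => sffOf Y ν z i j) y := by
  have dG : ∀ m, DifferentiableAt ℝ (fun z => metricOf Y z i m) y := fun m =>
    smooth_diff (contDiff_metricOf h.smooth i m) y
  have dS : ∀ m, DifferentiableAt ℝ (fun z => shapeOf Y ν z m j) y := fun m =>
    (hp.shape_two h m j).differentiableAt (by simp)
  rw [← partialD_congr (h.metric_mul_shape hp.det_ne_zero i j),
    partialD_sum _ fun m _ => (dG m).fun_mul (dS m)]
  simp only [fun m => partialD_mul (dG m) (dS m), hp.partialD_metric h.smooth, hp.metric_eq,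
    Matrix.one_apply]
  simp

lemma partialD_shape_symm (hp : IsPrincipalNormalAt Y ν y lam) (h : HasUnitNormal ρ Y ν)
    (k i j : Fin n) : partialD k (fun z => shapeOf Y ν z i j) y
      = partialD k (fun z => shapeOf Y ν z j i) y := by
  rw [hp.partialD_shape h, hp.partialD_shape h]
  simp only [h.sff_symm _ i j]

/-- The metric is constant only to first order at `y`, so its second derivative contributes; in
Simons' identity this correction cancels against the derivatives of `ν`. -/
lemma partialD_partialD_shape (hp : IsPrincipalNormalAt Y ν y lam) (h : HasUnitNormal ρ Y ν)
    (k i : Fin n) : partialD k (partialD k (fun z => shapeOf Y ν z i i)) y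
      = partialD k (partialD k (fun z => sffOf Y ν z i i)) y
        - lam i * partialD k (partialD k (fun z => metricOf Y z i i)) y := by
  have dG : ∀ m, ContDiffAt ℝ 2 (fun z => metricOf Y z i m) y := fun m =>
    smooth_two (contDiff_metricOf h.smooth i m) y
  have dS := fun m => hp.shape_two h m i
  rw [← partialD_congr (eventuallyEq_partialD (h.metric_mul_shape hp.det_ne_zero i i) k),
    partialD_partialD_sum _ fun m _ => (dG m).mul (dS m)]
  simp only [fun m => partialD_partialD_mul (dG m) (dS m) k k, hp.partialD_metric h.smooth,
    hp.metric_eq, hp.shape_eq, Matrix.one_apply, Matrix.diagonal_apply]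
  simp [Finset.sum_add_distrib]
  ring

/-- Simons' identity for the diagonal entries of the shape operator. -/
lemma simons (hp : IsPrincipalNormalAt Y ν y lam) (h : HasUnitNormal ρ Y ν) (hρ : ρ ≠ 0)
    (i k : Fin n) : partialD k (partialD k (fun z => shapeOf Y ν z i i)) y
      - partialD i (partialD i (fun z => shapeOf Y ν z k k)) y
      = (lam k - lam i) * (lam i * lam k - ρ⁻¹ ^ 2) := by
  rcases eq_or_ne i k with rfl | hik
  · simp
  have sm := fun a => ContDiff.partialD h.smooth a
  have smm := fun a b => ContDiff.partialD (sm b) a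
  have hA : ∀ a b, partialD a (partialD a (fun z => sffOf Y ν z b b)) y
      = mink (partialD a (partialD a ν) y) (partialD b (partialD b Y) y)
        + 2 * mink (partialD a ν y) (partialD a (partialD b (partialD b Y)) y)
        + mink (ν y) (partialD a (partialD a (partialD b (partialD b Y))) y) := fun a b =>
    partialD_partialD_mink h.smooth_normal (smm b b) y a
  -- The mixed Hessian `∂ₐ∂_bY` vanishes at `y` for `a ≠ b`, so only third derivatives of `Y`
  -- remain. They have exactly the form of those in `hA`, where `∂ₐν = -λₐ ∂ₐY`.
  have hG : ∀ a b, a ≠ b → partialD a (partialD a (fun z => metricOf Y z b b)) y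
      = 2 * mink (partialD b Y y) (partialD b (partialD a (partialD a Y)) y) := by
    intro a b hab
    have h1 : partialD a (partialD b Y) y = 0 := by
      rw [hp.hess_eq h hρ]; simp [hab]
    have h2 := partialD_partialD_mink (sm b) (sm b) y a
    rw [h1, mink_zero_left, partialD_comm_fun h.smooth a b, partialD_comm_fun (sm a) a b,
      mink_comm _ (partialD b Y y)] at h2
    refine Eq.trans h2 ?_
    ring
  have hνν : ∀ a, mink (partialD a (partialD a ν) y) (ν y) = -lam a ^ 2 := by
    intro a
    have h1 := partialD_partialD_mink h.smooth_normal h.smooth_normal y a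
    simp only [h.normal_self] at h1
    rw [show partialD a (fun _ : Coord n => (-1 : ℝ)) = fun _ => 0 from
      funext fun z => partialD_const _ _ _, partialD_const, mink_comm (ν y),
      hp.deriv_normal_eq h hρ, mink_smul_left, mink_smul_right] at h1
    have h2 : mink (partialD a Y y) (partialD a Y y) = 1 := by
      have := congrFun (congrFun hp.metric_eq a) a
      simpa [metricOf] using this
    rw [h2] at h1
    linarith
  have hνY : ∀ a, mink (partialD a (partialD a ν) y) (Y y) = lam a := by
    intro a
    have h1 := partialD_mink (smooth_diff (ContDiff.partialD h.smooth_normal a) y)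
      (smooth_diff h.smooth y) a
    simp only [h.deriv_normal_position, h.deriv_normal_tangent, hp.sff_eq, partialD_const,
      Matrix.diagonal_apply_eq] at h1
    linarith
  have hmain : ∀ a b, mink (partialD a (partialD a ν) y) (partialD b (partialD b Y) y)
      = lam b * lam a ^ 2 - ρ⁻¹ ^ 2 * lam a := by
    intro a b
    rw [hp.hess_eq h hρ, mink_sub_right, mink_smul_right, mink_smul_right, hνν, hνY]
    simp
  -- Ambient space is flat, so the fourth derivatives commute and drop out of the difference; the
  -- products of `∂²ν` with `∂²Y` alone give the right side.
  have h4 : partialD k (partialD k (partialD i (partialD i Y)))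
      = partialD i (partialD i (partialD k (partialD k Y))) := by
    rw [partialD_comm_fun (sm i) k i, partialD_comm_fun h.smooth k i,
      partialD_comm_fun (smm i k) k i, partialD_comm_fun (sm k) k i]
  rw [hp.partialD_partialD_shape h, hp.partialD_partialD_shape h, hA, hA, hG _ _ hik,
    hG _ _ hik.symm, hmain, hmain, h4, hp.deriv_normal_eq h hρ, hp.deriv_normal_eq h hρ,
    mink_smul_left, mink_smul_left]
  ring

/-- The elliptic inequality for `σ₂` at a maximum of the mean curvature. -/
lemma sum_partialD_sigma_le (hp : IsPrincipalNormalAt Y ν y lam) (h : HasUnitNormal ρ Y ν)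
    (hρ : ρ ≠ 0) (hmax : IsLocalMax (meanOf Y ν) y) (hlam : lam ∈ Gamma2 n) :
    ∑ k, partialD k (partialD k (sigmaOf Y ν)) y
      ≤ P2 lam * ∑ i, lam i ^ 2 + ρ⁻¹ ^ 2 * (∑ i, lam i) ^ 2 - n * ρ⁻¹ ^ 2 * ∑ i, lam i ^ 2 := by
  have s2 := hp.shape_two h
  have m2 : ContDiffAt ℝ 2 (meanOf Y ν) y :=
    (h.contDiffAt_mean hp.det_ne_zero).of_le (WithTop.coe_le_coe.2 le_top)
  have hHy : meanOf Y ν y = ∑ i, lam i := by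
    rw [meanOf, hp.shape_eq, Matrix.trace_diagonal]
  have hHkk : ∀ k, partialD k (partialD k (meanOf Y ν)) y
      = ∑ i, partialD k (partialD k (fun z => shapeOf Y ν z i i)) y := fun k =>
    partialD_partialD_sum Finset.univ (fun i _ => s2 i i) k k
  -- Of the first order terms, those with `∂ₖH` vanish at the maximum, and those with `∂ₖA` form
  -- minus a sum of squares and are discarded.
  have hsig : ∀ k, partialD k (partialD k (sigmaOf Y ν)) y
      ≤ (∑ i, lam i) * partialD k (partialD k (meanOf Y ν)) y
        - ∑ i, lam i * partialD k (partialD k (fun z => shapeOf Y ν z i i)) y := by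
    intro k
    have e : sigmaOf Y ν = fun z => (2 : ℝ)⁻¹ * (meanOf Y ν z * meanOf Y ν z)
        + (-(2 : ℝ)⁻¹) * ∑ i, ∑ j, shapeOf Y ν z i j * shapeOf Y ν z j i := by
      funext z
      simp only [sigmaOf, meanOf, Matrix.trace, Matrix.diag, Matrix.mul_apply]
      ring
    have c2 : ∀ i j, ContDiffAt ℝ 2 (fun z => shapeOf Y ν z i j * shapeOf Y ν z j i) y :=
      fun i j => (s2 i j).mul (s2 j i)
    have c3 : ∀ i, ContDiffAt ℝ 2 (fun z => ∑ j, shapeOf Y ν z i j * shapeOf Y ν z j i) y :=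
      fun i => ContDiffAt.sum fun j _ => c2 i j
    have c4 : ContDiffAt ℝ 2 (fun z => ∑ i, ∑ j, shapeOf Y ν z i j * shapeOf Y ν z j i) y :=
      ContDiffAt.sum fun i _ => c3 i
    have hij : ∀ i j, partialD k (partialD k (fun z => shapeOf Y ν z i j * shapeOf Y ν z j i)) y
        = (if i = j then 2 * lam i * partialD k (partialD k (fun z => shapeOf Y ν z i i)) y else 0)
          + 2 * partialD k (fun z => shapeOf Y ν z i j) y ^ 2 := by
      intro i j
      rw [partialD_partialD_mul (s2 i j) (s2 j i), hp.shape_eq, hp.partialD_shape_symm h k j i]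
      split_ifs with hij
      · subst hij
        rw [Matrix.diagonal_apply_eq]
        ring
      · rw [Matrix.diagonal_apply_ne _ hij, Matrix.diagonal_apply_ne' _ hij]
        ring
    rw [e, partialD_partialD_add (contDiffAt_const.mul (m2.mul m2)) (contDiffAt_const.mul c4),
      partialD_partialD_const_mul _ (m2.mul m2), partialD_partialD_const_mul _ c4,
      partialD_partialD_mul m2 m2, (partialD_of_isLocalMax hmax m2 k).1,
      partialD_partialD_sum _ fun i _ => c3 i]
    simp only [fun i => partialD_partialD_sum Finset.univ (fun j _ => c2 i j) k k, hij, hHy,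
      Finset.sum_add_distrib, Finset.sum_ite_eq, Finset.mem_univ, if_true, ← Finset.mul_sum,
      mul_assoc]
    have : 0 ≤ ∑ i, ∑ j, partialD k (fun z => shapeOf Y ν z i j) y ^ 2 :=
      Finset.sum_nonneg fun i _ => Finset.sum_nonneg fun j _ => sq_nonneg _
    linarith
  have hswap : ∑ k, ∑ i, lam i * partialD k (partialD k (fun z => shapeOf Y ν z i i)) y
      = ∑ k, lam k * partialD k (partialD k (meanOf Y ν)) y
        + ∑ k, ∑ i, lam i * ((lam k - lam i) * (lam i * lam k - ρ⁻¹ ^ 2)) := by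
    have : ∑ k, lam k * partialD k (partialD k (meanOf Y ν)) y
        = ∑ k, ∑ i, lam i * partialD i (partialD i (fun z => shapeOf Y ν z k k)) y := by
      rw [Finset.sum_comm]
      simp only [hHkk, Finset.mul_sum]
    rw [this, ← Finset.sum_add_distrib]
    refine Finset.sum_congr rfl fun k _ => ?_
    rw [← Finset.sum_add_distrib]
    refine Finset.sum_congr rfl fun i _ => ?_
    rw [← hp.simons h hρ i k]
    ring
  have hquartic : ∑ k, ∑ i, lam i * ((lam k - lam i) * (lam i * lam k - ρ⁻¹ ^ 2))
      = (∑ i, lam i ^ 2) ^ 2 - (∑ i, lam i) * ∑ i, lam i ^ 3 - ρ⁻¹ ^ 2 * (∑ i, lam i) ^ 2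
        + n * ρ⁻¹ ^ 2 * ∑ i, lam i ^ 2 := by
    have h1 : ∀ k i, lam i * ((lam k - lam i) * (lam i * lam k - ρ⁻¹ ^ 2))
        = lam k ^ 2 * lam i ^ 2 - lam k * lam i ^ 3 - ρ⁻¹ ^ 2 * (lam k * lam i)
          + ρ⁻¹ ^ 2 * lam i ^ 2 := fun k i => by ring
    simp only [h1, Finset.sum_add_distrib, Finset.sum_sub_distrib, ← Finset.mul_sum,
      ← Finset.sum_mul, Finset.sum_const, Finset.card_univ, Fintype.card_fin, nsmul_eq_mul]
    ring
  -- The maximum principle: nonnegative coefficients on `Γ₂` against nonpositive second derivatives.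
  have hell : ∑ k, (∑ i, lam i - lam k) * partialD k (partialD k (meanOf Y ν)) y ≤ 0 :=
    Finset.sum_nonpos fun k _ => mul_nonpos_of_nonneg_of_nonpos
      (sub_nonneg.2 (le_sum_of_mem_Gamma2 hlam k)) (partialD_of_isLocalMax hmax m2 k).2
  have hsum := Finset.sum_le_sum fun k (_ : k ∈ Finset.univ) => hsig k
  rw [Finset.sum_sub_distrib, hswap, hquartic] at hsum
  simp only [sub_mul, Finset.sum_sub_distrib] at hell
  have := sum_mul_sum_cube_le hlam
  linarith

end IsPrincipalNormalAt

end Simons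

/-! ### Behaviour under changes of coordinates -/

section CoordinateChange

variable {n : ℕ}

/-- The Jacobian matrix. -/
noncomputable def jac (τ : Coord n → Coord n) (u : Coord n) : Matrix (Fin n) (Fin n) ℝ :=
  Matrix.of fun a i => partialD i (fun z => τ z a) u

lemma metricOf_comp {Y : Coord n → Mink n} {τ : Coord n → Coord n} {u : Coord n}
    (hY : DifferentiableAt ℝ Y (τ u)) (hτ : DifferentiableAt ℝ τ u) :
    metricOf (fun z => Y (τ z)) u
      = (jac τ u).transpose * metricOf Y (τ u) * jac τ u := by
  ext i j
  simp only [metricOf, Matrix.of_apply, partialD_comp hY hτ, mink_sum_left, mink_sum_right,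
    mink_smul_left, mink_smul_right, Matrix.mul_apply, Matrix.transpose_apply, jac,
    Finset.sum_mul, Finset.mul_sum]
  exact Finset.sum_congr rfl fun a _ => Finset.sum_congr rfl fun b _ => by ring

/-- The second derivatives of `τ` multiply tangent vectors, which `ν` annihilates; hence the
tensorial transformation law. -/
lemma sffOf_comp {Y ν : Coord n → Mink n} {τ : Coord n → Coord n} {u : Coord n}
    (hY : ContDiffAt ℝ 2 Y (τ u)) (hτ : ContDiffAt ℝ 2 τ u)
    (hν : ∀ a, mink (ν (τ u)) (partialD a Y (τ u)) = 0) :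
    sffOf (fun z => Y (τ z)) (fun z => ν (τ z)) u
      = (jac τ u).transpose * sffOf Y ν (τ u) * jac τ u := by
  ext i j
  simp only [sffOf, Matrix.of_apply, partialD_partialD_comp hY hτ, mink_sum_right,
    mink_add_right, mink_smul_right, hν, Matrix.mul_apply, Matrix.transpose_apply, jac,
    Finset.sum_mul, Finset.mul_sum, mul_zero, zero_add]
  exact Finset.sum_congr rfl fun a _ => Finset.sum_congr rfl fun b _ => by ring

lemma HasUnitNormal.comp {ρ : ℝ} {Y ν : Coord n → Mink n} (h : HasUnitNormal ρ Y ν)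
    {φ : Coord n → Coord n} (hφ : ContDiff ℝ ∞ φ) :
    HasUnitNormal ρ (fun u => Y (φ u)) (fun u => ν (φ u)) where
  smooth := h.smooth.comp hφ
  smooth_normal := h.smooth_normal.comp hφ
  mink_self _ := h.mink_self _
  normal_position _ := h.normal_position _
  normal_tangent u i := by
    rw [partialD_comp (smooth_diff h.smooth _) (smooth_diff hφ u), mink_sum_right]
    simp only [mink_smul_right, h.normal_tangent, mul_zero, Finset.sum_const_zero]
  normal_self _ := h.normal_self _

lemma inv_mul_congruence {G A J : Matrix (Fin n) (Fin n) ℝ} (hJ : IsUnit J.det) :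
    (J.transpose * G * J)⁻¹ * (J.transpose * A * J) = J⁻¹ * (G⁻¹ * A) * J := by
  have hJt : IsUnit J.transpose.det := by rwa [Matrix.det_transpose]
  rw [Matrix.mul_inv_rev, Matrix.mul_inv_rev]
  simp only [Matrix.mul_assoc]
  rw [Matrix.nonsing_inv_mul_cancel_left _ _ hJt]

/-- Both fundamental forms change by congruence, so the shape operator changes by conjugation, which
leaves `H` and `σ₂` invariant. -/
lemma shapeOf_comp {ρ : ℝ} {Y ν : Coord n → Mink n} (h : HasUnitNormal ρ Y ν)
    {φ : Coord n → Coord n} (hφ : ContDiff ℝ ∞ φ) {u : Coord n}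
    (hJ : IsUnit (jac φ u).det) :
    shapeOf (fun z => Y (φ z)) (fun z => ν (φ z)) u
      = (jac φ u)⁻¹ * shapeOf Y ν (φ u) * jac φ u := by
  rw [shapeOf, metricOf_comp (smooth_diff h.smooth _) (smooth_diff hφ u),
    sffOf_comp (smooth_two h.smooth _) (smooth_two hφ u) (h.normal_tangent _),
    inv_mul_congruence hJ, shapeOf]

lemma meanOf_comp {ρ : ℝ} {Y ν : Coord n → Mink n} (h : HasUnitNormal ρ Y ν)
    {φ : Coord n → Coord n} (hφ : ContDiff ℝ ∞ φ) {u : Coord n}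
    (hJ : IsUnit (jac φ u).det) :
    meanOf (fun z => Y (φ z)) (fun z => ν (φ z)) u = meanOf Y ν (φ u) := by
  rw [meanOf, shapeOf_comp h hφ hJ, Matrix.trace_mul_comm,
    Matrix.mul_nonsing_inv_cancel_left _ _ hJ, meanOf]

lemma sigmaOf_comp {ρ : ℝ} {Y ν : Coord n → Mink n} (h : HasUnitNormal ρ Y ν)
    {φ : Coord n → Coord n} (hφ : ContDiff ℝ ∞ φ) {u : Coord n}
    (hJ : IsUnit (jac φ u).det) :
    sigmaOf (fun z => Y (φ z)) (fun z => ν (φ z)) u = sigmaOf Y ν (φ u) := by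
  have h1 := meanOf_comp h hφ hJ
  rw [meanOf, meanOf] at h1
  rw [sigmaOf, h1, sigmaOf, shapeOf_comp h hφ hJ]
  congr 2
  have : (jac φ u)⁻¹ * shapeOf Y ν (φ u) * jac φ u * ((jac φ u)⁻¹ * shapeOf Y ν (φ u) * jac φ u)
      = (jac φ u)⁻¹ * (shapeOf Y ν (φ u) * shapeOf Y ν (φ u) * jac φ u) := by
    simp only [Matrix.mul_assoc]
    rw [Matrix.mul_nonsing_inv_cancel_left _ _ hJ]
  rw [this, Matrix.trace_mul_comm, Matrix.mul_assoc, Matrix.mul_nonsing_inv _ hJ, Matrix.mul_one]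

/-- The quadratic change of coordinates `u ↦ y + E u - ½ T(u, u)`. -/
noncomputable def quadMap (y : Coord n) (E : Matrix (Fin n) (Fin n) ℝ)
    (T : Fin n → Fin n → Fin n → ℝ) (u : Coord n) : Coord n :=
  WithLp.toLp 2 fun a => y a + ∑ k, E a k * u k - (1 / 2) * ∑ k, ∑ l, T a k l * u k * u l

variable {y : Coord n} {E : Matrix (Fin n) (Fin n) ℝ} {T : Fin n → Fin n → Fin n → ℝ}

lemma quadMap_zero : quadMap y E T 0 = y := by
  ext a; simp [quadMap]

lemma contDiff_coord (k : Fin n) : ContDiff ℝ ∞ (fun u : Coord n => u k) :=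
  (EuclideanSpace.proj k : Coord n →L[ℝ] ℝ).contDiff

lemma contDiff_quadMap : ContDiff ℝ ∞ (quadMap y E T) := by
  rw [contDiff_euclidean]
  intro a
  refine (contDiff_const.add (ContDiff.sum fun k _ => contDiff_const.mul (contDiff_coord k))).sub
    (contDiff_const.mul (ContDiff.sum fun k _ => ContDiff.sum fun l _ => ?_))
  exact (contDiff_const.mul (contDiff_coord k)).mul (contDiff_coord l)

lemma partialD_quadMap (hT : ∀ a k l, T a k l = T a l k) (a i : Fin n) (u : Coord n) :
    partialD i (fun z => quadMap y E T z a) u = E a i - ∑ k, T a i k * u k := by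
  have c : ∀ k, DifferentiableAt ℝ (fun u : Coord n => u k) u := fun k =>
    smooth_diff (contDiff_coord k) u
  have d1 : ∀ k, DifferentiableAt ℝ (fun u : Coord n => E a k * u k) u := fun k =>
    (c k).const_mul _
  have d2 : ∀ k l, DifferentiableAt ℝ (fun u : Coord n => T a k l * u k * u l) u := fun k l =>
    ((c k).const_mul _).fun_mul (c l)
  have d3 : ∀ k, DifferentiableAt ℝ (fun u : Coord n => ∑ l, T a k l * u k * u l) u := fun k =>
    DifferentiableAt.fun_sum fun l _ => d2 k l
  have e : (fun z => quadMap y E T z a)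
      = fun u => (y a + ∑ k, E a k * u k) - (1 / 2) * ∑ k, ∑ l, T a k l * u k * u l := rfl
  rw [e, partialD_sub (DifferentiableAt.fun_add (differentiableAt_const _)
      (DifferentiableAt.fun_sum fun k _ => d1 k))
      ((DifferentiableAt.fun_sum fun k _ => d3 k).const_mul _),
    partialD_add (differentiableAt_const _) (DifferentiableAt.fun_sum fun k _ => d1 k),
    partialD_const, partialD_sum _ fun k _ => d1 k,
    partialD_const_mul _ (DifferentiableAt.fun_sum fun k _ => d3 k),
    partialD_sum _ fun k _ => d3 k]
  simp only [fun k => partialD_sum Finset.univ (fun l _ => d2 k l) i,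
    fun k => partialD_const_mul (E a k) (c k) i,
    fun k l => partialD_mul ((c k).const_mul (T a k l)) (c l) i,
    fun k l => partialD_const_mul (T a k l) (c k) i, partialD_coord, Finset.sum_add_distrib]
  simp only [mul_ite, mul_one, mul_zero, ite_mul, zero_mul, Finset.sum_ite_eq',
    Finset.mem_univ, if_true, zero_add, Finset.sum_ite_irrel, Finset.sum_const_zero]
  have : ∑ k, T a k i * u k = ∑ k, T a i k * u k := Finset.sum_congr rfl fun k _ => by rw [hT]
  rw [this]
  ring

lemma partialD_partialD_quadMap (hT : ∀ a k l, T a k l = T a l k) (a i j : Fin n) (u : Coord n) :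
    partialD j (partialD i (fun z => quadMap y E T z a)) u = -T a i j := by
  have c : ∀ k, DifferentiableAt ℝ (fun u : Coord n => T a i k * u k) u := fun k =>
    (smooth_diff (contDiff_coord k) u).const_mul _
  rw [show partialD i (fun z => quadMap y E T z a) = fun u => E a i - ∑ k, T a i k * u k from
    funext fun u => partialD_quadMap hT a i u, partialD_sub (differentiableAt_const _)
    (DifferentiableAt.fun_sum fun k _ => c k), partialD_const, partialD_sum _ fun k _ => c k]
  simp only [fun k => partialD_const_mul (T a i k) (smooth_diff (contDiff_coord k) u) j,
    partialD_coord]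
  simp

lemma jac_quadMap (hT : ∀ a k l, T a k l = T a l k) : jac (quadMap y E T) 0 = E := by
  ext a i
  rw [jac, Matrix.of_apply, partialD_quadMap hT]
  simp

end CoordinateChange

/-! ### The curvature estimate at a maximum of `H`, in arbitrary coordinates -/

section MaximumPrinciple

variable {n : ℕ}

/-- The Laplace-Beltrami operator of the metric with components `G`. -/
noncomputable def lapOf (G : Coord n → Matrix (Fin n) (Fin n) ℝ) (f : Coord n → ℝ)
    (y : Coord n) : ℝ :=
  ∑ a, ∑ b, (G y)⁻¹ a b * (partialD b (partialD a f) y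
    - ∑ c, christoffel G c a b y * partialD c f y)

variable {ρ : ℝ} {Y ν : Coord n → Mink n} {y : Coord n} {lam : Fin n → ℝ}
  {E : Matrix (Fin n) (Fin n) ℝ}

/-- The Christoffel symbols of `Y` at `y` in the basis `E`. -/
noncomputable def christoffelIn (Y : Coord n → Mink n) (y : Coord n)
    (E : Matrix (Fin n) (Fin n) ℝ) (c i j : Fin n) : ℝ :=
  ∑ a, ∑ b, christoffel (metricOf Y) c a b y * E a j * E b i

lemma christoffelIn_symm (hY : ContDiff ℝ ∞ Y) (c i j : Fin n) :
    christoffelIn Y y E c i j = christoffelIn Y y E c j i := by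
  rw [christoffelIn, Finset.sum_comm, christoffelIn]
  refine Finset.sum_congr rfl fun a _ => Finset.sum_congr rfl fun b _ => ?_
  rw [christoffel_metricOf_symm hY]; ring

/-- The linear part `E` diagonalizes both forms, and the quadratic part is the Christoffel symbol in
the basis `E`, chosen to cancel the tangential part of the Hessian. -/
lemma HasUnitNormal.isPrincipalNormalAt (h : HasUnitNormal ρ Y ν) (hρ : ρ ≠ 0)
    (hdet : (metricOf Y y).det ≠ 0) (hG : E.transpose * metricOf Y y * E = 1)
    (hA : E.transpose * sffOf Y ν y * E = Matrix.diagonal lam) :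
    IsPrincipalNormalAt (fun u => Y (quadMap y E (christoffelIn Y y E) u))
      (fun u => ν (quadMap y E (christoffelIn Y y E) u)) 0 lam := by
  have hT := christoffelIn_symm (y := y) (E := E) h.smooth
  have hJ := jac_quadMap (y := y) (E := E) hT
  have h2 : ContDiffAt ℝ 2 (quadMap y E (christoffelIn Y y E)) 0 := smooth_two contDiff_quadMap 0
  refine ⟨?_, ?_, ?_⟩
  · rw [metricOf_comp (smooth_diff h.smooth _) (smooth_diff contDiff_quadMap _), hJ, quadMap_zero,
      hG]
  · rw [sffOf_comp (smooth_two h.smooth _) h2 (h.normal_tangent _), hJ, quadMap_zero, hA]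
  · intro i j l
    have hl : ∀ v, (∀ m, mink v (partialD m Y y) = 0) →
        mink v (partialD l (fun u => Y (quadMap y E (christoffelIn Y y E) u)) 0) = 0 := by
      intro v hv
      rw [partialD_comp (smooth_diff h.smooth _) (smooth_diff contDiff_quadMap _), quadMap_zero,
        mink_sum_right]
      simp only [mink_smul_right, hv, mul_zero, Finset.sum_const_zero]
    apply hl
    intro m
    rw [partialD_partialD_comp (smooth_two h.smooth _) h2]
    simp only [partialD_quadMap hT, partialD_partialD_quadMap hT, quadMap_zero]
    simp only [PiLp.zero_apply, mul_zero, Finset.sum_const_zero, sub_zero, mink_sum_left,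
      mink_add_left, mink_smul_left, h.gauss_formula hρ hdet, mink_sub_left, h.normal_tangent,
      h.position_tangent]
    have : ∀ c, christoffelIn Y y E c j i
        = ∑ a, E a j * ∑ b, E b i * christoffel (metricOf Y) c b a y := by
      intro c
      rw [christoffelIn, Finset.sum_comm]
      refine Finset.sum_congr rfl fun a _ => ?_
      rw [Finset.mul_sum]
      exact Finset.sum_congr rfl fun b _ => by ring
    simp only [this, Finset.sum_add_distrib, Finset.mul_sum, Finset.sum_mul, neg_mul,
      Finset.sum_neg_distrib]
    rw [Finset.sum_comm, add_eq_zero_iff_eq_neg.2]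
    congr 1
    refine Finset.sum_congr rfl fun a _ => ?_
    rw [Finset.sum_comm]
    exact Finset.sum_congr rfl fun b _ => Finset.sum_congr rfl fun c _ => by ring

/-- The adapted coordinates depend on the embedding through `E`. The flat Laplacian at their origin
is nevertheless the Laplace-Beltrami operator, which depends only on the metric. -/
lemma sum_partialD_comp_quadMap {f : Coord n → ℝ} (hY : ContDiff ℝ ∞ Y)
    (hG : E.transpose * metricOf Y y * E = 1) (hf : ContDiffAt ℝ 2 f y) :
    ∑ k, partialD k (partialD k fun u => f (quadMap y E (christoffelIn Y y E) u)) 0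
      = lapOf (metricOf Y) f y := by
  have hT := christoffelIn_symm (y := y) (E := E) hY
  have h2 : ContDiffAt ℝ 2 (quadMap y E (christoffelIn Y y E)) 0 := smooth_two contDiff_quadMap 0
  have hf' : ContDiffAt ℝ 2 f (quadMap y E (christoffelIn Y y E) 0) := by rwa [quadMap_zero]
  simp only [partialD_partialD_comp hf' h2, partialD_quadMap hT, partialD_partialD_quadMap hT,
    quadMap_zero, PiLp.zero_apply, mul_zero, Finset.sum_const_zero, sub_zero, smul_eq_mul,
    Finset.sum_add_distrib, lapOf, inv_eq_mul_transpose hG, mul_sub, Finset.sum_sub_distrib,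
    Matrix.mul_apply, Matrix.transpose_apply]
  have e1 : ∑ k, ∑ a, E a k * ∑ b, E b k * partialD b (partialD a f) y
      = ∑ a, ∑ b, (∑ k, E a k * E b k) * partialD b (partialD a f) y := by
    simp only [Finset.mul_sum, Finset.sum_mul]
    rw [Finset.sum_comm]
    refine Finset.sum_congr rfl fun a _ => ?_
    rw [Finset.sum_comm]
    exact Finset.sum_congr rfl fun b _ => Finset.sum_congr rfl fun k _ => by ring
  have e2 : ∑ k, ∑ c, -christoffelIn Y y E c k k * partialD c f y
      = -∑ a, ∑ b, (∑ k, E a k * E b k) *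
        ∑ c, christoffel (metricOf Y) c a b y * partialD c f y := by
    simp only [christoffelIn, Finset.mul_sum, Finset.sum_mul, neg_mul, Finset.sum_neg_distrib]
    congr 1
    calc _ = ∑ a, ∑ k, ∑ c, ∑ b,
          christoffel (metricOf Y) c a b y * E a k * E b k * partialD c f y := by
          rw [Finset.sum_comm (γ := Fin n) (s := Finset.univ) (t := Finset.univ)
            (f := fun a k => ∑ c, ∑ b,
              christoffel (metricOf Y) c a b y * E a k * E b k * partialD c f y)]
          exact Finset.sum_congr rfl fun k _ => Finset.sum_comm
      _ = _ := by
          refine Finset.sum_congr rfl fun a _ => ?_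
          rw [Finset.sum_congr rfl fun k _ => Finset.sum_comm, Finset.sum_comm]
          refine Finset.sum_congr rfl fun b _ => ?_
          rw [Finset.sum_comm]
          exact Finset.sum_congr rfl fun c _ => Finset.sum_congr rfl fun k _ => by ring
  rw [e1, e2]
  ring

/-- Curvature estimate at a maximum of the mean curvature. -/
lemma HasUnitNormal.estimate_at_max (h : HasUnitNormal ρ Y ν) (hρ : ρ ≠ 0)
    (hdet : (metricOf Y y).det ≠ 0) (hG : E.transpose * metricOf Y y * E = 1)
    (hA : E.transpose * sffOf Y ν y * E = Matrix.diagonal lam) (hlam : lam ∈ Gamma2 n)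
    (hmax : IsLocalMax (meanOf Y ν) y) :
    ((n - 1) * ρ⁻¹ ^ 2 - P2 lam) * ∑ i, lam i ^ 2
      ≤ 2 * ρ⁻¹ ^ 2 * P2 lam - lapOf (metricOf Y) (sigmaOf Y ν) y := by
  have hφ : ContDiff ℝ ∞ (quadMap y E (christoffelIn Y y E)) := contDiff_quadMap
  set φ := quadMap y E (christoffelIn Y y E) with hφd
  have hφ0 : φ 0 = y := quadMap_zero
  have hp := h.isPrincipalNormalAt hρ hdet hG hA
  rw [← hφd] at hp
  have hJ0 : IsUnit (jac φ 0).det := by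
    rw [jac_quadMap (christoffelIn_symm h.smooth), isUnit_iff_ne_zero]
    intro h0
    have := congrArg Matrix.det hG
    rw [Matrix.det_mul, h0, mul_zero, Matrix.det_one] at this
    exact zero_ne_one this
  -- The quadratic map need not be a diffeomorphism globally; invertibility of its Jacobian near the
  -- origin is enough to compare germs of `H` and `σ₂`.
  have hJ : ∀ᶠ u in 𝓝 (0 : Coord n), IsUnit (jac φ u).det := by
    have hc : ContinuousAt (fun u => (jac φ u).det) 0 :=
      (contDiffAt_det (k := 0) fun a i => ((ContDiff.partialD (contDiff_euclidean.1 hφ a) i).of_le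
        (by simp)).contDiffAt).continuousAt
    filter_upwards [hc.eventually_ne hJ0.ne_zero] with u hu using isUnit_iff_ne_zero.2 hu
  have em : meanOf (fun z => Y (φ z)) (fun z => ν (φ z)) =ᶠ[𝓝 0] fun u => meanOf Y ν (φ u) := by
    filter_upwards [hJ] with u hu using meanOf_comp h hφ hu
  have es : sigmaOf (fun z => Y (φ z)) (fun z => ν (φ z)) =ᶠ[𝓝 0] fun u => sigmaOf Y ν (φ u) := by
    filter_upwards [hJ] with u hu using sigmaOf_comp h hφ hu
  have hmax' : IsLocalMax (meanOf (fun z => Y (φ z)) (fun z => ν (φ z))) 0 := by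
    have h1 : IsLocalMax (fun u => meanOf Y ν (φ u)) 0 := by
      have h0 : IsLocalMax (meanOf Y ν) (φ 0) := by rwa [hφ0]
      exact h0.comp_continuous hφ.continuous.continuousAt
    filter_upwards [em, h1] with u hu h1
    rw [hu, em.self_of_nhds]
    exact h1
  have key := hp.sum_partialD_sigma_le (h.comp hφ) hρ hmax' hlam
  rw [Finset.sum_congr rfl fun k _ => partialD_congr (eventuallyEq_partialD es k) k,
    sum_partialD_comp_quadMap h.smooth hG
      ((h.contDiffAt_sigma hdet).of_le (WithTop.coe_le_coe.2 le_top)),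
    sum_sq_add_P2] at key
  linarith

end MaximumPrinciple

/-! ### Passage to the sphere and compactness -/

section SphereCharts

variable {n : ℕ}

/-- The charts are stereographic projections, so `param` is smooth on all of coordinate space and
the local theory applies without restricting domains. -/
lemma extChartAt_target_univ (p : Sph n) : (extChartAt (𝓡 n) p).target = Set.univ := by
  have : Fact (Module.finrank ℝ (EuclideanSpace ℝ (Fin (n + 1))) = n + 1) :=
    ⟨finrank_euclideanSpace_fin⟩
  have h : (chartAt (EuclideanSpace ℝ (Fin n)) p).target = Set.univ := stereographic'_target (-p)
  rw [extChartAt_target, h]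
  simp

lemma param_mem_source (p : Sph n) (y : Coord n) : param p y ∈ (extChartAt (𝓡 n) p).source :=
  (extChartAt (𝓡 n) p).map_target (by rw [extChartAt_target_univ]; trivial)

lemma extChartAt_param (p : Sph n) (y : Coord n) : extChartAt (𝓡 n) p (param p y) = y :=
  (extChartAt (𝓡 n) p).right_inv (by rw [extChartAt_target_univ]; trivial)

lemma param_extChartAt {p q : Sph n} (h : p ∈ (extChartAt (𝓡 n) q).source) :
    param q (extChartAt (𝓡 n) q p) = p :=
  (extChartAt (𝓡 n) q).left_inv h

lemma param_base (p : Sph n) : param p (base p) = p := param_extChartAt (mem_extChartAt_source p)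

lemma contMDiff_param (p : Sph n) : ContMDiff 𝓘(ℝ, Coord n) (𝓡 n) ∞ (param p) := by
  have h := contMDiffOn_extChartAt_symm (I := 𝓡 n) (n := ∞) p
  rw [extChartAt_target_univ] at h
  exact contMDiffOn_univ.1 h

lemma mfderiv_param_injective (p : Sph n) (y : Coord n) :
    Function.Injective (mfderiv 𝓘(ℝ, Coord n) (𝓡 n) (param p) y) := by
  have h := isInvertible_mfderivWithin_extChartAt_symm (I := 𝓡 n) (x := p) (y := y)
    (by rw [extChartAt_target_univ]; trivial)
  rw [ModelWithCorners.range_eq_univ, mfderivWithin_univ] at h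
  exact h.injective

variable {X : Sph n → Mink n}

lemma contDiff_comp_param (hX : ContMDiff (𝓡 n) 𝓘(ℝ, Mink n) ∞ X) (p : Sph n) :
    ContDiff ℝ ∞ (fun y => X (param p y)) :=
  (hX.comp (contMDiff_param p)).contDiff

lemma fderiv_comp_param (hX : ContMDiff (𝓡 n) 𝓘(ℝ, Mink n) ∞ X) (p : Sph n) (y v : Coord n) :
    fderiv ℝ (fun y => X (param p y)) y v
      = mfderiv (𝓡 n) 𝓘(ℝ, Mink n) X (param p y)
        (mfderiv 𝓘(ℝ, Coord n) (𝓡 n) (param p) y v) := by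
  have h := mfderiv_comp (I := 𝓘(ℝ, Coord n)) (I' := 𝓡 n) (I'' := 𝓘(ℝ, Mink n)) y
    (hX.mdifferentiableAt (by simp)) ((contMDiff_param p).mdifferentiableAt (by simp) (x := y))
  rw [← mfderiv_eq_fderiv]
  exact congrArg (fun L => L v) h

variable {g : SphMetric n} {ρ : ℝ} {ν : Sph n → Mink n}

lemma IsIsometricEmbedding.metricComp_eq (h : IsIsometricEmbedding g ρ X) (p : Sph n) :
    metricComp g p = metricOf (fun y => X (param p y)) := by
  funext y
  ext i j
  simp only [metricComp, metricOf, Matrix.of_apply, partialD, fderiv_comp_param h.contMDiff,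
    h.isometric]

lemma IsIsometricEmbedding.posDef (h : IsIsometricEmbedding g ρ X) (p : Sph n) (y : Coord n) :
    (metricOf (fun y => X (param p y)) y).PosDef := by
  refine Matrix.PosDef.of_dotProduct_mulVec_pos (Matrix.ext fun i j => ?_) fun {x} hx => ?_
  · simpa using metricOf_symm _ y j i
  · set v : Coord n := WithLp.toLp 2 x with hv
    have hv0 : v ≠ 0 := fun h0 => hx (by simpa [hv] using h0)
    have e : star x ⬝ᵥ Matrix.mulVec (metricOf (fun y => X (param p y)) y) x
        = mink (fderiv ℝ (fun y => X (param p y)) y v) (fderiv ℝ (fun y => X (param p y)) y v) := by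
      have hva : ∀ a, v a = x a := fun _ => rfl
      rw [fderiv_eq_sum_partialD _ y v]
      simp only [mink_sum_left, mink_sum_right, mink_smul_left,
        mink_smul_right, dotProduct, Matrix.mulVec, metricOf, Matrix.of_apply, Finset.mul_sum,
        star_trivial, hva]
      rw [Finset.sum_comm]
      refine Finset.sum_congr rfl fun a _ => Finset.sum_congr rfl fun b _ => ?_
      rw [mink_comm]; ring
    rw [e, fderiv_comp_param h.contMDiff, h.isometric]
    refine g.pos _ _ fun h0 => hv0 ?_
    exact mfderiv_param_injective p y (h0.trans (map_zero _).symm)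

lemma IsIsometricEmbedding.det_ne_zero (h : IsIsometricEmbedding g ρ X) (p : Sph n)
    (y : Coord n) : (metricOf (fun y => X (param p y)) y).det ≠ 0 :=
  (h.posDef p y).det_pos.ne'

lemma IsIsometricEmbedding.hasUnitNormal (h : IsIsometricEmbedding g ρ X) (hρ : ρ ≠ 0)
    (hν : IsDownwardUnitNormal X ν) (p : Sph n) :
    HasUnitNormal ρ (fun y => X (param p y)) (fun y => ν (param p y)) := by
  have hY := contDiff_comp_param h.contMDiff p
  have hYY : ∀ y, mink (X (param p y)) (X (param p y)) = ρ ^ 2 := fun y => h.mem_deSitter _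
  have hνt : ∀ y i, mink (ν (param p y)) (partialD i (fun y => X (param p y)) y) = 0 := by
    intro y i
    rw [partialD, fderiv_comp_param h.contMDiff]
    exact hν.normal _ _
  refine ⟨hY, ?_, hYY, fun y => hν.tangent _, hνt, fun y => hν.unit _⟩
  refine contDiff_normal hρ hY (h.det_ne_zero p) hYY ?_ (fun y => hν.tangent _) hνt
    (fun y => hν.unit _) (fun y => hν.downward _)
  intro y i
  have h1 := partialD_mink (smooth_diff hY y) (smooth_diff hY y) i
  simp only [hYY, partialD_const] at h1
  rw [mink_comm] at h1
  linarith

lemma metricOf_congr {Y Z : Coord n → Mink n} {y : Coord n} (h : Y =ᶠ[𝓝 y] Z) :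
    metricOf Y y = metricOf Z y := by
  ext i j
  simp only [metricOf, Matrix.of_apply, partialD_congr h]

lemma sffOf_congr {Y Z ν μ : Coord n → Mink n} {y : Coord n} (h : Y =ᶠ[𝓝 y] Z)
    (hν : ν y = μ y) : sffOf Y ν y = sffOf Z μ y := by
  ext i j
  simp only [sffOf, Matrix.of_apply, partialD_congr (eventuallyEq_partialD h j), hν]

/-- Principal curvatures can be read off in any chart. -/
lemma IsPrincipalCurvatures.in_chart (h : IsIsometricEmbedding g ρ X) (hρ : ρ ≠ 0)
    (hν : IsDownwardUnitNormal X ν) {p q : Sph n} (hp : p ∈ (extChartAt (𝓡 n) q).source)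
    {lam : Fin n → ℝ} (hl : IsPrincipalCurvatures g X ν p lam) :
    ∃ E : Matrix (Fin n) (Fin n) ℝ,
      E.transpose * metricOf (fun y => X (param q y)) (extChartAt (𝓡 n) q p) * E = 1 ∧
      E.transpose * sffOf (fun y => X (param q y)) (fun y => ν (param q y))
        (extChartAt (𝓡 n) q p) * E = Matrix.diagonal lam := by
  -- The given basis `E` lives in the chart at `p`; the Jacobian of the transition map carries it to
  -- the chart at `q`.
  obtain ⟨E, hG, hA⟩ := hl
  have hN := h.hasUnitNormal hρ hν q
  set τ : Coord n → Coord n := fun z => extChartAt (𝓡 n) q (param p z) with hτd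
  have hτ0 : τ (base p) = extChartAt (𝓡 n) q p := by rw [hτd]; simp only [param_base]
  have hτ : ContDiffAt ℝ 2 τ (base p) := by
    have hc : ContMDiffAt (𝓡 n) 𝓘(ℝ, Coord n) ∞ (extChartAt (𝓡 n) q) (param p (base p)) := by
      rw [param_base]
      exact contMDiffAt_extChartAt' (by rwa [extChartAt_source] at hp)
    exact ((hc.comp _ (contMDiff_param p).contMDiffAt).contDiffAt).of_le
      (WithTop.coe_le_coe.2 le_top)
  have hev : ∀ᶠ z in 𝓝 (base p), param p z ∈ (extChartAt (𝓡 n) q).source := by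
    refine (contMDiff_param p).continuous.continuousAt.eventually ?_
    rw [param_base]
    exact (isOpen_extChartAt_source q).mem_nhds hp
  have eY : (fun z => X (param p z)) =ᶠ[𝓝 (base p)] fun z => X (param q (τ z)) := by
    filter_upwards [hev] with z hz
    rw [hτd, param_extChartAt hz]
  have eν : ν (param p (base p)) = ν (param q (τ (base p))) := by
    rw [hτd, param_extChartAt hev.self_of_nhds]
  have e1 : metricComp g p (base p) = (jac τ (base p)).transpose
      * metricOf (fun y => X (param q y)) (extChartAt (𝓡 n) q p) * jac τ (base p) := by
    rw [h.metricComp_eq, metricOf_congr eY, ← hτ0]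
    exact metricOf_comp (smooth_diff hN.smooth _) (hτ.differentiableAt (by simp))
  have e2 : secondFF X ν p = (jac τ (base p)).transpose
      * sffOf (fun y => X (param q y)) (fun y => ν (param q y)) (extChartAt (𝓡 n) q p)
      * jac τ (base p) := by
    have : secondFF X ν p = sffOf (fun z => X (param p z)) (fun z => ν (param p z)) (base p) := by
      ext i j
      simp only [secondFF, sffOf, Matrix.of_apply, param_base]
    rw [this, sffOf_congr (μ := fun z => ν (param q (τ z))) eY eν, ← hτ0]
    exact sffOf_comp (Y := fun y => X (param q y)) (ν := fun y => ν (param q y))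
      (smooth_two hN.smooth _) hτ (hN.normal_tangent _)
  refine ⟨jac τ (base p) * E, ?_, ?_⟩
  · rw [← hG, e1, Matrix.transpose_mul]
    simp only [Matrix.mul_assoc]
  · rw [← hA, e2, Matrix.transpose_mul]
    simp only [Matrix.mul_assoc]

/-- An admissible isometric embedding together with its downward unit normal. -/
structure IsAdmissibleEmbedding (g : SphMetric n) (ρ : ℝ) (X ν : Sph n → Mink n) : Prop where
  isometric : IsIsometricEmbedding g ρ X
  normal : IsDownwardUnitNormal X ν
  admissible : Admissible g X ν

/-- The mean curvature at a point of the sphere. -/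
noncomputable def meanAt (X ν : Sph n → Mink n) (p : Sph n) : ℝ :=
  meanOf (fun y => X (param p y)) (fun y => ν (param p y)) (base p)

namespace IsAdmissibleEmbedding

/-- One and the same `lam` serves all charts around `p`. This makes `H` chart independent and allows
the estimate to be carried out in a fixed chart at `q` while `p` varies. -/
lemma exists_principal (h : IsAdmissibleEmbedding g ρ X ν) (hρ : ρ ≠ 0) (p : Sph n) :
    ∃ lam ∈ Gamma2 n, normSqA g X ν p = ∑ i, lam i ^ 2 ∧ meanAt X ν p = ∑ i, lam i ∧
      ∀ q, p ∈ (extChartAt (𝓡 n) q).source → ∃ E : Matrix (Fin n) (Fin n) ℝ,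
      E.transpose * metricOf (fun y => X (param q y)) (extChartAt (𝓡 n) q p) * E = 1 ∧
      E.transpose * sffOf (fun y => X (param q y)) (fun y => ν (param q y))
        (extChartAt (𝓡 n) q p) * E = Matrix.diagonal lam ∧
      meanOf (fun y => X (param q y)) (fun y => ν (param q y)) (extChartAt (𝓡 n) q p)
        = ∑ i, lam i ∧
      sigmaOf (fun y => X (param q y)) (fun y => ν (param q y)) (extChartAt (𝓡 n) q p)
        = P2 lam := by
  obtain ⟨lam, hl, hlam⟩ := h.admissible p
  have key : ∀ q, p ∈ (extChartAt (𝓡 n) q).source → ∃ E : Matrix (Fin n) (Fin n) ℝ,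
      E.transpose * metricOf (fun y => X (param q y)) (extChartAt (𝓡 n) q p) * E = 1 ∧
      E.transpose * sffOf (fun y => X (param q y)) (fun y => ν (param q y))
        (extChartAt (𝓡 n) q p) * E = Matrix.diagonal lam ∧
      meanOf (fun y => X (param q y)) (fun y => ν (param q y)) (extChartAt (𝓡 n) q p)
        = ∑ i, lam i ∧
      sigmaOf (fun y => X (param q y)) (fun y => ν (param q y)) (extChartAt (𝓡 n) q p)
        = P2 lam := by
    intro q hq
    obtain ⟨E, hG, hA⟩ := hl.in_chart h.isometric hρ h.normal hq
    refine ⟨E, hG, hA, ?_, ?_⟩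
    · rw [meanOf, shapeOf, trace_inv_mul hG hA]
    · rw [sigmaOf, shapeOf, trace_inv_mul hG hA, trace_inv_mul_sq hG hA, sum_sq_add_P2]
      ring
  refine ⟨lam, hlam, ?_, ?_, key⟩
  · obtain ⟨E, hG, hA⟩ := hl
    exact sum_inv_mul_inv hG hA
  · obtain ⟨E, -, -, hm, -⟩ := key p (mem_extChartAt_source p)
    exact hm

lemma meanAt_eq (h : IsAdmissibleEmbedding g ρ X ν) (hρ : ρ ≠ 0) {p q : Sph n}
    (hp : p ∈ (extChartAt (𝓡 n) q).source) :
    meanAt X ν p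
      = meanOf (fun y => X (param q y)) (fun y => ν (param q y)) (extChartAt (𝓡 n) q p) := by
  obtain ⟨lam, -, -, hm, hq⟩ := h.exists_principal hρ p
  obtain ⟨E, -, -, hm', -⟩ := hq q hp
  rw [hm, hm']

lemma continuous_meanAt (h : IsAdmissibleEmbedding g ρ X ν) (hρ : ρ ≠ 0) :
    Continuous (meanAt X ν) := by
  rw [continuous_iff_continuousAt]
  intro q
  have h1 : ContinuousAt (meanOf (fun y => X (param q y)) (fun y => ν (param q y)))
      (extChartAt (𝓡 n) q q) := ((h.isometric.hasUnitNormal hρ h.normal q).contDiffAt_mean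
        (h.isometric.det_ne_zero q _)).continuousAt
  refine (ContinuousAt.comp h1 (continuousAt_extChartAt q)).congr ?_
  filter_upwards [extChartAt_source_mem_nhds (I := 𝓡 n) q] with p hp
  exact (h.meanAt_eq hρ hp).symm

lemma isLocalMax_meanOf (h : IsAdmissibleEmbedding g ρ X ν) (hρ : ρ ≠ 0) {p q : Sph n}
    (hp : p ∈ (extChartAt (𝓡 n) q).source) (hmax : ∀ p', meanAt X ν p' ≤ meanAt X ν p) :
    IsLocalMax (meanOf (fun y => X (param q y)) (fun y => ν (param q y)))
      (extChartAt (𝓡 n) q p) := by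
  refine Eventually.of_forall fun z => ?_
  have h1 := h.meanAt_eq hρ (param_mem_source q z)
  rw [extChartAt_param] at h1
  rw [← h1, ← h.meanAt_eq hρ hp]
  exact hmax _

/-- The right side does not mention the embedding: any two admissible embeddings have the same `σ₂`.
This is the source of uniformity. -/
lemma sigmaOf_eq (h : IsAdmissibleEmbedding g ρ X ν) (hρ : ρ ≠ 0) (q : Sph n) :
    sigmaOf (fun y => X (param q y)) (fun y => ν (param q y))
      = fun y => (ρ⁻¹ ^ 2 * n * (n - 1) - scalar (metricComp g q) y) / 2 := by
  funext y
  rw [h.isometric.metricComp_eq, (h.isometric.hasUnitNormal hρ h.normal q).scalar_eq hρ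
    (h.isometric.det_ne_zero q)]
  ring

end IsAdmissibleEmbedding

lemma contDiffAt_lapOf {Y : Coord n → Mink n} (hY : ContDiff ℝ ∞ Y) {y : Coord n}
    (hdet : (metricOf Y y).det ≠ 0) {f : Coord n → ℝ} (hf : ContDiffAt ℝ ∞ f y) :
    ContDiffAt ℝ ∞ (lapOf (metricOf Y) f) y := by
  refine ContDiffAt.sum fun a _ => ContDiffAt.sum fun b _ => ContDiffAt.mul
    (contDiffAt_inv (fun i j => (contDiff_metricOf hY i j).contDiffAt) hdet a b)
    (ContDiffAt.sub (ContDiffAt.partialD (ContDiffAt.partialD hf (m := ∞) (by simp) a) (by simp) b)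
      (ContDiffAt.sum fun c _ => ?_))
  exact (contDiffAt_christoffel hY hdet c a b).mul (ContDiffAt.partialD hf (by simp) c)

/-- Near each point there is a bound, depending only on `g` and `ρ`, for the maximum of the mean
curvature of an admissible embedding, if it is attained there. -/
lemma exists_local_bound (hρ : 0 < ρ) {X₀ ν₀ : Sph n → Mink n}
    (h₀ : IsAdmissibleEmbedding g ρ X₀ ν₀) (q : Sph n)
    (hq : sigmaOf (fun y => X₀ (param q y)) (fun y => ν₀ (param q y)) (base q)
      < (n - 1) * ρ⁻¹ ^ 2) :
    ∃ C : ℝ, ∀ᶠ p in 𝓝 q, ∀ X ν : Sph n → Mink n, IsAdmissibleEmbedding g ρ X ν →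
      (∀ p', meanAt X ν p' ≤ meanAt X ν p) → meanAt X ν p ^ 2 ≤ C := by
  set f := sigmaOf (fun y => X₀ (param q y)) (fun y => ν₀ (param q y)) with hf
  set G := metricComp g q with hG
  have hG₀ := h₀.isometric.metricComp_eq q
  have hN := h₀.isometric.hasUnitNormal hρ.ne' h₀.normal q
  have hdet := h₀.isometric.det_ne_zero q (base q)
  have hfs : ContDiffAt ℝ ∞ f (base q) := hN.contDiffAt_sigma hdet
  have hls : ContinuousAt (lapOf G f) (base q) := by
    rw [hG, hG₀]
    exact (contDiffAt_lapOf hN.smooth hdet hfs).continuousAt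
  set δ := (n - 1) * ρ⁻¹ ^ 2 - f (base q) with hδ
  have hδ0 : 0 < δ := sub_pos.2 hq
  set M := f (base q) + δ / 2 with hM
  set L := lapOf G f (base q) - 1 with hL
  -- Near `q`, continuity gives `σ₂ < M`, which is `δ / 2` below the threshold `(n - 1) ρ⁻²`, and
  -- `Δσ₂ > L`. The quotient then bounds `|A|²`, and `2 M` accounts for `H² = |A|² + 2 σ₂`.
  refine ⟨(2 * ρ⁻¹ ^ 2 * M - L) / (δ / 2) + 2 * M, ?_⟩
  have e1 : ∀ᶠ y in 𝓝 (base q), f y < M :=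
    hfs.continuousAt.eventually_lt continuousAt_const (by linarith)
  have e2 : ∀ᶠ y in 𝓝 (base q), L < lapOf G f y :=
    continuousAt_const.eventually_lt hls (by linarith)
  have hc := (continuousAt_extChartAt (I := 𝓡 n) q).eventually (e1.and e2)
  filter_upwards [extChartAt_source_mem_nhds (I := 𝓡 n) q, hc] with p hp hpf X ν h hmax
  obtain ⟨lam, hlam, -, hm, hE⟩ := h.exists_principal hρ.ne' p
  obtain ⟨E, hEG, hEA, -, hEs⟩ := hE q hp
  have hest := (h.isometric.hasUnitNormal hρ.ne' h.normal q).estimate_at_max hρ.ne'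
    (h.isometric.det_ne_zero q _) hEG hEA hlam (h.isLocalMax_meanOf hρ.ne' hp hmax)
  -- The constants were built from the reference embedding `X₀`; they apply to `X` because `σ₂` is
  -- intrinsic.
  have hfe : sigmaOf (fun y => X (param q y)) (fun y => ν (param q y)) = f := by
    rw [hf, h.sigmaOf_eq hρ.ne', h₀.sigmaOf_eq hρ.ne']
  rw [← h.isometric.metricComp_eq, hfe] at hest
  rw [hfe] at hEs
  obtain ⟨h1, h2⟩ := hpf
  rw [hEs] at h1
  have hN0 : 0 ≤ ∑ i, lam i ^ 2 := Finset.sum_nonneg fun i _ => sq_nonneg _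
  have h3 : δ / 2 * ∑ i, lam i ^ 2 ≤ 2 * ρ⁻¹ ^ 2 * M - L := by
    have hK : 0 < ρ⁻¹ ^ 2 := by positivity
    have h4 : δ / 2 * ∑ i, lam i ^ 2 ≤ ((n - 1) * ρ⁻¹ ^ 2 - P2 lam) * ∑ i, lam i ^ 2 :=
      mul_le_mul_of_nonneg_right (by linarith) hN0
    have h5 : 2 * ρ⁻¹ ^ 2 * P2 lam ≤ 2 * ρ⁻¹ ^ 2 * M :=
      mul_le_mul_of_nonneg_left h1.le (by linarith)
    linarith
  have h6 : ∑ i, lam i ^ 2 ≤ (2 * ρ⁻¹ ^ 2 * M - L) / (δ / 2) := by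
    rw [le_div_iff₀ (by linarith)]
    linarith
  rw [hm, sum_sq_add_P2]
  linarith

/-- The curvature bound, provided that `σ₂ < (n - 1) ρ⁻²` for admissible embeddings. -/
theorem exists_curvatureBound (hρ : 0 < ρ)
    (hσ : ∀ X ν : Sph n → Mink n, IsAdmissibleEmbedding g ρ X ν → ∀ q : Sph n,
      sigmaOf (fun y => X (param q y)) (fun y => ν (param q y)) (base q)
        < (n - 1) * ρ⁻¹ ^ 2) :
    ∃ C : ℝ, 0 < C ∧ CurvatureBound g ρ C := by
  -- Without an admissible embedding the bound is vacuous. Otherwise one is fixed as a reference,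
  -- from which the smoothness of `σ₂` in charts is read off.
  by_cases hex : ∃ X₀ ν₀ : Sph n → Mink n, IsAdmissibleEmbedding g ρ X₀ ν₀
  swap
  · exact ⟨1, one_pos, fun X ν h1 h2 h3 => absurd ⟨X, ν, h1, h2, h3⟩ hex⟩
  obtain ⟨X₀, ν₀, h₀⟩ := hex
  obtain ⟨C, hC⟩ : ∃ C : ℝ, ∀ p ∈ (Set.univ : Set (Sph n)), ∀ X ν : Sph n → Mink n,
      IsAdmissibleEmbedding g ρ X ν →
      (∀ p', meanAt X ν p' ≤ meanAt X ν p) → meanAt X ν p ^ 2 ≤ C := by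
    refine isCompact_univ.induction_on (p := fun s => ∃ C : ℝ, ∀ p ∈ s, ∀ X ν : Sph n → Mink n,
      IsAdmissibleEmbedding g ρ X ν →
      (∀ p', meanAt X ν p' ≤ meanAt X ν p) → meanAt X ν p ^ 2 ≤ C) ?_ ?_ ?_ ?_
    · exact ⟨0, fun p hp => hp.elim⟩
    · rintro s t hst ⟨C, hC⟩
      exact ⟨C, fun p hp => hC p (hst hp)⟩
    · rintro s t ⟨C, hC⟩ ⟨D, hD⟩
      refine ⟨max C D, fun p hp X ν h hmax => ?_⟩
      rcases hp with hp | hp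
      · exact (hC p hp X ν h hmax).trans (le_max_left _ _)
      · exact (hD p hp X ν h hmax).trans (le_max_right _ _)
    · intro q _
      obtain ⟨C, hC⟩ := exists_local_bound hρ h₀ q (hσ X₀ ν₀ h₀ q)
      exact ⟨_, mem_nhdsWithin_of_mem_nhds hC, C, fun p hp => hp⟩
  refine ⟨max C 1, lt_max_of_lt_right one_pos, fun X ν h1 h2 h3 p => ?_⟩
  have h : IsAdmissibleEmbedding g ρ X ν := ⟨h1, h2, h3⟩
  obtain ⟨m, -, hm⟩ := isCompact_univ.exists_isMaxOn ⟨p, Set.mem_univ p⟩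
    (h.continuous_meanAt hρ.ne').continuousOn
  have hm' : ∀ p', meanAt X ν p' ≤ meanAt X ν m := fun p' => hm (Set.mem_univ p')
  obtain ⟨lam, hlam, hA, hH, -⟩ := h.exists_principal hρ.ne' p
  have hpos := sum_pos_of_mem_Gamma2 hlam
  have hP := P2_pos_of_mem_Gamma2 hlam
  calc normSqA g X ν p ≤ meanAt X ν p ^ 2 := by
        rw [hA, hH, sum_sq_add_P2]; linarith
    _ ≤ meanAt X ν m ^ 2 := pow_le_pow_left₀ (by rw [hH]; exact hpos.le) (hm' p) 2
    _ ≤ C := hC m (Set.mem_univ m) X ν h hm'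
    _ ≤ max C 1 := le_max_left _ _

end SphereCharts

end WeylDeSitter

/-! ### The two assertions -/

open WeylDeSitter in
theorem theorem1 :
    (∀ g : SphMetric 2, PositiveCurvature g →
      ∃ ρ₀ : ℝ, 0 < ρ₀ ∧ ∀ ρ : ℝ, 0 < ρ → ρ < ρ₀ →
        ∃ C : ℝ, 0 < C ∧ CurvatureBound g ρ C) ∧
    (∀ n : ℕ, 2 ≤ n → ∀ (g : SphMetric n) (ρ : ℝ), 0 < ρ →
      (∀ p : Sph n,
        ρ⁻¹ ^ 2 * (n : ℝ) * ((n : ℝ) - 2) < scalarCurvature g p ∧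
        scalarCurvature g p < ρ⁻¹ ^ 2 * (n : ℝ) * ((n : ℝ) - 1)) →
      ∃ C : ℝ, 0 < C ∧ CurvatureBound g ρ C) := by
  -- The value `ρ₀ = 1` is arbitrary: positive curvature gives `σ₂ < ρ⁻²` for every `ρ > 0`.
  refine ⟨fun g hg => ⟨1, one_pos, fun ρ hρ _ => exists_curvatureBound hρ fun X ν h q => ?_⟩,
    fun n hn g ρ hρ hR => exists_curvatureBound hρ fun X ν h q => ?_⟩
  · have hsec := hg q ![1, 0] ![0, 1] (by
      rw [LinearIndependent.pair_iff]
      intro s t hst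
      have h0 := congrFun hst 0
      have h1 := congrFun hst 1
      simp at h0 h1
      exact ⟨h0, h1⟩)
    rw [h.isometric.metricComp_eq] at hsec
    have := (h.isometric.hasUnitNormal hρ.ne' h.normal q).sigma_lt_of_sectional_pos hρ.ne'
      (fun y => (h.isometric.posDef q y).det_pos) (base q) hsec
    norm_num
    simpa using this
  · have h1 := (hR q).1
    have h2 : (2 : ℝ) ≤ n := by exact_mod_cast hn
    have hK : 0 < ρ⁻¹ ^ 2 := by positivity
    rw [h.sigmaOf_eq hρ.ne']
    rw [scalarCurvature] at h1
    -- The lower bound on `R` gives `σ₂ < ρ⁻² n / 2`, and the hint `ρ⁻² (n - 2) ≥ 0` says that `ρ⁻²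
    -- n / 2 ≤ (n - 1) ρ⁻²`.
    nlinarith [mul_nonneg hK.le (sub_nonneg.2 h2)]
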